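/- **Theorem.** Let $\mathbb H=\{z\in\mathbb C:\operatorname{Im}z>0\}$. Let $\mathcal P$ be the set of Pick functions, i.e. of the holomorphic functions $\Phi$ on $\mathbb C\setminus\mathbb R$ with $\operatorname{Im}\Phi(z)/\operatorname{Im}z\ge 0$ for $z\in\mathbb C\setminus\mathbb R$ and $\Phi(z)=\overline{\Phi(\bar z)}$. Let $$\mathcal P_{\int}=\{f \text{ holomorphic on }\mathbb C\setminus\mathbb R:\ f'\in\mathcal P,\ f(-i)=\overline{f(i)}\},\qquad \log\mathcal P=\{\log\Phi:\ \Phi\in\mathcal P,\ \Phi\not\equiv0\},$$ where $\log\Phi$ is the principal logarithm ($0\le\arg\Phi\le\pi$) on $\mathbb H$ and is extended to $-\mathbb H$ by $\log\Phi(z)=\overline{\log\Phi(\bar z)}$. Let $N$ be the set of non-decreasing functions $\nu:\mathbb R\to[0,1]$. For $\nu\in N$ put $\nu(-\infty)=\lim_{t\to-\infty}\nu(t)$, $\nu(x\pm0)=\lim_{t\to x\pm}\nu(t)$, and let $d\nu$ be the Lebesgue–Stieltjes measure of $\nu$. 1. A function $f$ belongs to $\mathcal P_{\int}\cap\log\mathcal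 P$ if and only if there are $\beta\in\mathbb R$ and $\nu\in N$ with $$f(z)=\beta+\int_{-\infty}^{\infty}\Big(\frac1{t-z}-\frac t{1+t^2}\Big)\nu(t)\,dt,\qquad z\in\mathbb C\setminus\mathbb R,\tag{A}$$ and if and only if there are $\beta\in\mathbb R$ and $\nu\in N$ with $$f(z)=\beta+i\pi\nu(-\infty)+\int_{-\infty}^{\infty}\log\frac{\sqrt{1+t^2}}{t-z}\,d\nu(t),\qquad z\in\mathbb H,\tag{B}$$ (principal logarithm) and $f(z)=\overline{f(\bar z)}$ for $z\in-\mathbb H$. For given $\beta\in\mathbb R$ and $\nu\in N$ the two representations are equivalent, and both integrals converge absolutely. 2. The representations are unique up to equality almost everywhere: if $f$ is represented by $(\beta_1,\nu_1)$ in the form (A) [in the form (B)], then it is represented by $(\beta_2,\nu_2)$, with $\nu_2\in N$, in the same form if and only if $\beta_1=\beta_2$ and $\nu_1=\nu_2$ Lebesgue-almost everywhere. Let $f\in\mathcal P_{\int}\cap\log\mathcal P$ be represented by $(\beta,\nu)$. 3. For almost every $x\in\mathbb R$ the measure $d\nu$ has no mass at $x$, the function $t\mapsto\log\frac{\sqrt{1+t^2}}{|t-x|}$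 is $d\nu$-integrable, and the non-tangential limit of $\operatorname{Re}f$ at $x$ exists and equals $$\beta+\int_{-\infty}^{\infty}\log\frac{\sqrt{1+t^2}}{|t-x|}\,d\nu(t).$$ 4. If $\nu(x)=\tfrac12\big(\nu(x+0)+\nu(x-0)\big)$ for every $x\in\mathbb R$, then $\lim_{y\downarrow0}\operatorname{Im}f(x+iy)=\pi\nu(x)$ for every $x\in\mathbb R$. 5. (i) $f$ is constant on $\mathbb H$ if and only if $\nu$ is a constant function. (ii) If $f$ is constant on $\mathbb H$, then there is $\theta\in[0,1]$ with $\nu(x)=\theta$ for all $x\in\mathbb R$ and $f(z)=\beta+i\pi\theta$ for all $z\in\mathbb H$. (iii) If $f$ is not constant on $\mathbb H$, then $\operatorname{Im}f(z)>0$ and $\operatorname{Im}f'(z)>0$ for all $z\in\mathbb H$. -/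

import Mathlib

open Set Filter Topology MeasureTheory
open scoped ComplexConjugate

noncomputable section

/-- The Pick functions. A function on `ℂ \ ℝ` is represented by a function on `ℂ` whose values
on the real line are irrelevant. -/
def PickClass : Set (ℂ → ℂ) :=
  {Φ | DifferentiableOn ℂ Φ {z : ℂ | z.im ≠ 0} ∧
    (∀ z : ℂ, z.im ≠ 0 → 0 ≤ (Φ z).im / z.im) ∧
    (∀ z : ℂ, z.im < 0 → Φ z = conj (Φ (conj z)))}

/-- Symmetric primitives of Pick functions. -/
def PrimPickClass : Set (ℂ → ℂ) :=
  {f | DifferentiableOn ℂ f {z : ℂ | z.im ≠ 0} ∧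
    deriv f ∈ PickClass ∧ f (-Complex.I) = conj (f Complex.I)}

/-- The logarithms `log Φ` of the Pick functions `Φ` that are not identically zero: principal
logarithm in the upper half plane, extended by symmetry to the lower half plane. -/
def LogPickClass : Set (ℂ → ℂ) :=
  {f | ∃ Φ ∈ PickClass, (∃ z : ℂ, z.im ≠ 0 ∧ Φ z ≠ 0) ∧
    (∀ z : ℂ, 0 < z.im → f z = Complex.log (Φ z)) ∧
    (∀ z : ℂ, z.im < 0 → f z = conj (f (conj z)))}

/-- Non-decreasing functions on the real line with values in `[0, 1]`. -/
def IsPickDensity (ν : ℝ → ℝ) : Prop :=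
  Monotone ν ∧ ∀ x, ν x ∈ Icc (0 : ℝ) 1

/-- The Lebesgue-Stieltjes measure induced by a non-decreasing function, which gives `(a, b]`
the mass `ν (b+0) - ν (a+0)`. -/
def lsMeasure (ν : ℝ → ℝ) (hν : Monotone ν) : Measure ℝ :=
  hν.stieltjesFunction.measure

/-- The kernel `1 / (t - z) - t / (1 + t ^ 2)`. -/
def pickKernel (z : ℂ) (t : ℝ) : ℂ :=
  1 / ((t : ℂ) - z) - (t : ℂ) / (1 + (t : ℂ) ^ 2)

/-- The kernel `log (√(1 + t ^ 2) / (t - z))`, with the principal logarithm. -/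
def logKernel (z : ℂ) (t : ℝ) : ℂ :=
  Complex.log ((Real.sqrt (1 + t ^ 2) : ℂ) / ((t : ℂ) - z))

/-- The kernel `log (√(1 + t ^ 2) / |t - x|)`. -/
def logPotKernel (x t : ℝ) : ℝ :=
  Real.log (Real.sqrt (1 + t ^ 2) / |t - x|)

/-- `f(z) = β + ∫ (1 / (t - z) - t / (1 + t ^ 2)) ν(t) dt` for all non-real `z`. -/
def HasCauchyForm (f : ℂ → ℂ) (β : ℝ) (ν : ℝ → ℝ) : Prop :=
  ∀ z : ℂ, z.im ≠ 0 → f z = (β : ℂ) + ∫ t : ℝ, pickKernel z t * (ν t : ℂ)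

/-- `f(z) = β + i π ν(-∞) + ∫ log (√(1 + t ^ 2) / (t - z)) dν(t)` for all `z` in the upper half
plane, `f` being extended by symmetry to the lower half plane. -/
def HasLogForm (f : ℂ → ℂ) (β : ℝ) (ν : ℝ → ℝ) (hν : Monotone ν) : Prop :=
  (∀ z : ℂ, 0 < z.im → f z = (β : ℂ) + Complex.I * (Real.pi : ℂ) * ((limUnder atBot ν : ℝ) : ℂ)
    + ∫ t : ℝ, logKernel z t ∂(lsMeasure ν hν)) ∧
  (∀ z : ℂ, z.im < 0 → f z = conj (f (conj z)))

/-- The real function `u` on the upper half plane has the finite non-tangential limit `l` at the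
real point `x`: the limit in every angle `{|Re z - x| ≤ a Im z}`. -/
def HasNontangentialLimit (u : ℂ → ℝ) (x l : ℝ) : Prop :=
  ∀ a : ℝ, 0 < a →
    Tendsto u (𝓝[{z : ℂ | 0 < z.im ∧ |z.re - x| ≤ a * z.im}] (x : ℂ)) (𝓝 l)

/-- `ν(x) = (ν(x+0) + ν(x-0)) / 2` at every point `x`. -/
def IsMidpointNormalized (ν : ℝ → ℝ) : Prop :=
  ∀ x, ν x = (Function.rightLim ν x + Function.leftLim ν x) / 2

/-- `f` is identically constant on the upper half plane. -/
def IsConstOnUpper (f : ℂ → ℂ) : Prop :=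
  ∃ c : ℂ, ∀ z : ℂ, 0 < z.im → f z = c

end

/-! ### The Cauchy kernel -/

/-! The class consists of the symmetric holomorphic `f` with `0 ≤ Im f ≤ π` and `Im f' ≥ 0` on the
upper half plane (`IsStripPrimitive`): a strip-valued `f` is the logarithm of the Pick function `exp
f`. Since `Im f'` is the derivative of `Im f` along horizontal lines, `Im f` is a bounded harmonic
function that is non-decreasing in `x`. Form (A) says that it is the Poisson integral of a boundary
function `π ν` with the same range and monotonicity; the imaginary part of `pickKernel` is `π` times
the Poisson kernel.

Poisson averaging preserves range and monotonicity, which gives one direction. For the other,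
`ν_ε(x) = Im f(x + iε) / π` is a density with a Lipschitz bound. The Poisson integral of `π ν_ε`
differs from `Im f(z + iε)` by a bounded harmonic function tending to zero uniformly at the real
line, so Phragmén–Lindelöf makes them equal (`im_add_eq_cauchyTransform`). Helly selection as `ε →
0` yields `ν`, and `f` then differs from the Cauchy transform by a real constant.

Form (B) is (A) integrated by parts: `logKernel z` is the tail integral of `pickKernel z`, and
Fubini exchanges the two integrations. Uniqueness comes from `Re f(i) = β` and from the vertical
limits of `Im f`. The boundary values of `Re f` follow by dominated convergence in an angle, at
every `x` where the logarithmic potential of `dν` converges absolutely and `dν` has no mass. Strict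
positivity is the open mapping theorem, applied to `f` and to `f'`. -/

lemma ofReal_sub_ne_zero_of_im_ne_zero {z : ℂ} (hz : z.im ≠ 0) (t : ℝ) : (t : ℂ) - z ≠ 0 := by
  intro h
  apply hz
  have := congrArg Complex.im h
  simpa using this

lemma one_add_ofReal_sq_ne_zero (t : ℝ) : (1 : ℂ) + (t : ℂ) ^ 2 ≠ 0 := by
  have h : (0 : ℝ) < 1 + t ^ 2 := by positivity
  exact_mod_cast h.ne'

lemma abs_im_le_norm_ofReal_sub (z : ℂ) (t : ℝ) : |z.im| ≤ ‖(t : ℂ) - z‖ := by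
  have := Complex.abs_im_le_norm ((t : ℂ) - z)
  simpa using this

lemma norm_ofReal_sub_I_sq (t : ℝ) : ‖(t : ℂ) - Complex.I‖ ^ 2 = 1 + t ^ 2 := by
  rw [← Complex.normSq_eq_norm_sq, Complex.normSq_apply]
  simp
  ring

/-- Triangle inequality through `z`, with `|Im z| ≤ |t - z|` absorbing the constant term. It
converts every bound in `|t - z|` into one in `1 + t ^ 2`. -/
lemma norm_ofReal_sub_I_le {z : ℂ} (hz : z.im ≠ 0) (t : ℝ) :
    ‖(t : ℂ) - Complex.I‖ ≤ (1 + ‖z - Complex.I‖ / |z.im|) * ‖(t : ℂ) - z‖ := by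
  have h0 : 0 < |z.im| := abs_pos.2 hz
  have h1 := abs_im_le_norm_ofReal_sub z t
  have h2 : ‖(t : ℂ) - Complex.I‖ ≤ ‖(t : ℂ) - z‖ + ‖z - Complex.I‖ := by
    simpa using norm_add_le ((t : ℂ) - z) (z - Complex.I)
  have h3 : ‖z - Complex.I‖ ≤ ‖z - Complex.I‖ / |z.im| * ‖(t : ℂ) - z‖ := by
    rw [div_mul_eq_mul_div, le_div_iff₀ h0]
    gcongr
  linarith

lemma norm_one_div_sub_sq_le {z : ℂ} (hz : z.im ≠ 0) (t : ℝ) :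
    ‖1 / ((t : ℂ) - z) ^ 2‖ ≤ (1 + ‖z - Complex.I‖ / |z.im|) ^ 2 * (1 + t ^ 2)⁻¹ := by
  have h0 : 0 < ‖(t : ℂ) - z‖ := norm_pos_iff.2 (ofReal_sub_ne_zero_of_im_ne_zero hz t)
  have h1 := norm_ofReal_sub_I_le hz t
  have h2 : (0 : ℝ) < 1 + t ^ 2 := by positivity
  rw [norm_div, norm_one, norm_pow, ← div_eq_mul_inv, div_le_div_iff₀ (by positivity) h2, one_mul,
    ← norm_ofReal_sub_I_sq, ← mul_pow]
  gcongr

/-- Each half of the kernel decays only like `1 / t`. Splitting off the value at `i` leaves two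
terms that are visibly `O(1 / t ^ 2)`. -/
lemma pickKernel_eq_add {z : ℂ} (hz : z.im ≠ 0) (t : ℝ) :
    pickKernel z t = (z - Complex.I) * (1 / (((t : ℂ) - z) * ((t : ℂ) - Complex.I))) +
      Complex.I * (1 / (1 + (t : ℂ) ^ 2)) := by
  have h1 := ofReal_sub_ne_zero_of_im_ne_zero hz t
  have h2 : (t : ℂ) - Complex.I ≠ 0 := ofReal_sub_ne_zero_of_im_ne_zero (by simp) t
  have h3 : (t : ℂ) + Complex.I ≠ 0 := by
    simpa using ofReal_sub_ne_zero_of_im_ne_zero (z := -Complex.I) (by simp) t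
  have h4 : (1 : ℂ) + (t : ℂ) ^ 2 = ((t : ℂ) - Complex.I) * ((t : ℂ) + Complex.I) := by
    ring_nf
    simp
    ring
  rw [pickKernel, h4]
  field_simp
  ring_nf

lemma norm_pickKernel_le {z : ℂ} (hz : z.im ≠ 0) (t : ℝ) :
    ‖pickKernel z t‖ ≤
      (‖z - Complex.I‖ * (1 + ‖z - Complex.I‖ / |z.im|) + 1) * (1 + t ^ 2)⁻¹ := by
  have h0 : 0 < ‖(t : ℂ) - z‖ := norm_pos_iff.2 (ofReal_sub_ne_zero_of_im_ne_zero hz t)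
  have h0' : 0 < ‖(t : ℂ) - Complex.I‖ :=
    norm_pos_iff.2 (ofReal_sub_ne_zero_of_im_ne_zero (by simp) t)
  have h1 := norm_ofReal_sub_I_le hz t
  have h2 : (0 : ℝ) < 1 + t ^ 2 := by positivity
  have h3 : ‖1 / (((t : ℂ) - z) * ((t : ℂ) - Complex.I))‖ ≤
      (1 + ‖z - Complex.I‖ / |z.im|) * (1 + t ^ 2)⁻¹ := by
    rw [norm_div, norm_one, norm_mul, ← div_eq_mul_inv, div_le_div_iff₀ (by positivity) h2,
      one_mul, ← norm_ofReal_sub_I_sq, pow_two, ← mul_assoc]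
    gcongr
  have h4 : ‖1 / (1 + (t : ℂ) ^ 2)‖ = (1 + t ^ 2)⁻¹ := by
    have : (1 : ℂ) + (t : ℂ) ^ 2 = ((1 + t ^ 2 : ℝ) : ℂ) := by push_cast; ring
    rw [this, norm_div, norm_one, Complex.norm_real, Real.norm_of_nonneg h2.le, one_div]
  rw [pickKernel_eq_add hz]
  refine (norm_add_le _ _).trans ?_
  rw [norm_mul, norm_mul, Complex.norm_I, h4, add_mul, mul_assoc]
  gcongr

lemma continuous_pickKernel {z : ℂ} (hz : z.im ≠ 0) : Continuous (pickKernel z) := by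
  unfold pickKernel
  refine (continuous_const.div (by fun_prop) fun t => ofReal_sub_ne_zero_of_im_ne_zero hz t).sub
    (Continuous.div (by fun_prop) (by fun_prop) fun t => one_add_ofReal_sq_ne_zero t)

lemma integrable_pickKernel {z : ℂ} (hz : z.im ≠ 0) : Integrable (pickKernel z) :=
  (integrable_inv_one_add_sq.const_mul _).mono' (continuous_pickKernel hz).aestronglyMeasurable
    (Eventually.of_forall (norm_pickKernel_le hz))

lemma pickKernel_im (z : ℂ) (t : ℝ) :
    (pickKernel z t).im = z.im / ((t - z.re) ^ 2 + z.im ^ 2) := by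
  have h : (t : ℂ) / (1 + (t : ℂ) ^ 2) = ((t / (1 + t ^ 2) : ℝ) : ℂ) := by push_cast; ring
  rw [pickKernel, h, Complex.sub_im, Complex.ofReal_im, one_div, Complex.inv_im,
    Complex.normSq_apply]
  simp
  ring

/-- This is the normalisation that makes `β = Re f(i)`. -/
lemma pickKernel_I_re (t : ℝ) : (pickKernel Complex.I t).re = 0 := by
  have h : (t : ℂ) / (1 + (t : ℂ) ^ 2) = ((t / (1 + t ^ 2) : ℝ) : ℂ) := by push_cast; ring
  rw [pickKernel, h, Complex.sub_re, Complex.ofReal_re, one_div, Complex.inv_re,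
    Complex.normSq_apply]
  simp
  ring

lemma pickKernel_conj (z : ℂ) (t : ℝ) : pickKernel (conj z) t = conj (pickKernel z t) := by
  simp [pickKernel]

lemma hasDerivAt_pickKernel {z : ℂ} (hz : z.im ≠ 0) (t : ℝ) :
    HasDerivAt (fun w => pickKernel w t) (1 / ((t : ℂ) - z) ^ 2) z := by
  have h := ((hasDerivAt_id z).const_sub (t : ℂ)).inv (ofReal_sub_ne_zero_of_im_ne_zero hz t)
  have h' := h.sub_const ((t : ℂ) / (1 + (t : ℂ) ^ 2))
  simpa [pickKernel] using h'

/-! ### Densities -/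

namespace IsPickDensity

variable {ν : ℝ → ℝ}

lemma measurable (hν : IsPickDensity ν) : Measurable ν := hν.1.measurable

lemma norm_le_one (hν : IsPickDensity ν) (t : ℝ) : ‖ν t‖ ≤ 1 := by
  rw [Real.norm_eq_abs, abs_of_nonneg (hν.2 t).1]
  exact (hν.2 t).2

lemma integrable_mul_ofReal (hν : IsPickDensity ν) {φ : ℝ → ℂ} (hφ : Integrable φ) :
    Integrable fun t => φ t * (ν t : ℂ) := by
  refine hφ.mono (hφ.1.mul
    (Complex.measurable_ofReal.comp hν.measurable).aestronglyMeasurable)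
    (Eventually.of_forall fun t => ?_)
  rw [norm_mul, Complex.norm_real]
  exact mul_le_of_le_one_right (norm_nonneg _) (hν.norm_le_one t)

lemma integrable_inv_one_add_sq_mul (hν : IsPickDensity ν) (x y : ℝ) :
    Integrable fun s : ℝ => (1 + s ^ 2)⁻¹ * ν (x + y * s) := by
  refine integrable_inv_one_add_sq.mono (integrable_inv_one_add_sq.1.mul
    (hν.measurable.comp (by fun_prop)).aestronglyMeasurable)
    (Eventually.of_forall fun t => ?_)
  rw [norm_mul]
  exact mul_le_of_le_one_right (norm_nonneg _) (hν.norm_le_one _)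

end IsPickDensity

/-! ### The Cauchy transform of a density -/

/-- The regularised Cauchy transform `∫ (1 / (t - z) - t / (1 + t ^ 2)) ν(t) dt`. -/
noncomputable def cauchyTransform (ν : ℝ → ℝ) (z : ℂ) : ℂ :=
  ∫ t : ℝ, pickKernel z t * (ν t : ℂ)

lemma hasCauchyForm_iff {f : ℂ → ℂ} {β : ℝ} {ν : ℝ → ℝ} :
    HasCauchyForm f β ν ↔ ∀ z : ℂ, z.im ≠ 0 → f z = β + cauchyTransform ν z := Iff.rfl

section

variable {ν : ℝ → ℝ}

lemma integrable_pickKernel_mul (hν : IsPickDensity ν) {z : ℂ} (hz : z.im ≠ 0) :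
    Integrable fun t => pickKernel z t * (ν t : ℂ) :=
  hν.integrable_mul_ofReal (integrable_pickKernel hz)

lemma isOpen_im_ne_zero : IsOpen {z : ℂ | z.im ≠ 0} :=
  isOpen_ne_fun Complex.continuous_im continuous_const

lemma differentiableOn_cauchyTransform (hν : IsPickDensity ν) :
    DifferentiableOn ℂ (cauchyTransform ν) {z : ℂ | z.im ≠ 0} := by
  intro z hz
  have hz0 : 0 < |z.im| := abs_pos.2 hz
  have key : ∀ w ∈ Metric.ball z (|z.im| / 2), |z.im| / 2 ≤ |w.im| := by
    intro w hw
    rw [mem_ball_iff_norm] at hw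
    have h1 : |(w - z).im| ≤ ‖w - z‖ := Complex.abs_im_le_norm _
    have h2 := abs_sub_abs_le_abs_sub z.im w.im
    rw [Complex.sub_im, abs_sub_comm] at h1
    linarith
  have key' : ∀ w ∈ Metric.ball z (|z.im| / 2), w.im ≠ 0 := fun w hw => by
    have := key w hw
    exact abs_pos.1 (by linarith)
  have hs : Metric.ball z (|z.im| / 2) ∈ 𝓝 z := Metric.ball_mem_nhds _ (by positivity)
  -- On the disc of radius `|Im z| / 2` one has `|Im w| ≥ |Im z| / 2` and `|w - i| ≤ |z - i| + |Im
  -- z| / 2`; inserting these in `norm_one_div_sub_sq_le` gives the bound.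
  have h := (hasDerivAt_integral_of_dominated_loc_of_deriv_le (μ := volume) (𝕜 := ℂ)
    (F := fun w t => pickKernel w t * (ν t : ℂ)) (F' := fun w t => 1 / ((t : ℂ) - w) ^ 2 * (ν t : ℂ))
    (x₀ := z)
    (bound := fun t => (1 + (‖z - Complex.I‖ + |z.im| / 2) / (|z.im| / 2)) ^ 2 * (1 + t ^ 2)⁻¹) hs
    ?_ (integrable_pickKernel_mul hν hz) ?_ ?_ (integrable_inv_one_add_sq.const_mul _) ?_).2
  · exact h.differentiableAt.differentiableWithinAt
  · filter_upwards [hs] with w hw using (integrable_pickKernel_mul hν (key' w hw)).1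
  · refine AEStronglyMeasurable.mul ?_
      (Complex.measurable_ofReal.comp hν.measurable).aestronglyMeasurable
    refine Continuous.aestronglyMeasurable ?_
    exact continuous_const.div (by fun_prop)
      fun t => pow_ne_zero _ (ofReal_sub_ne_zero_of_im_ne_zero hz t)
  · refine Eventually.of_forall fun t w hw => ?_
    rw [norm_mul, Complex.norm_real]
    refine (mul_le_of_le_one_right (norm_nonneg _) (hν.norm_le_one t)).trans ?_
    refine (norm_one_div_sub_sq_le (key' w hw) t).trans ?_
    have h1 := key w hw
    have h2 : ‖w - Complex.I‖ ≤ ‖z - Complex.I‖ + |z.im| / 2 := by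
      have := norm_add_le (w - z) (z - Complex.I)
      rw [mem_ball_iff_norm] at hw
      rw [sub_add_sub_cancel] at this
      linarith
    gcongr
  · exact Eventually.of_forall fun t w hw => (hasDerivAt_pickKernel (key' w hw) t).mul_const _

lemma cauchyTransform_conj (ν : ℝ → ℝ) (z : ℂ) :
    cauchyTransform ν (conj z) = conj (cauchyTransform ν z) := by
  rw [cauchyTransform, cauchyTransform, ← integral_conj]
  simp [pickKernel_conj]

lemma cauchyTransform_I_re (hν : IsPickDensity ν) : (cauchyTransform ν Complex.I).re = 0 := by
  have h := integral_re (integrable_pickKernel_mul hν (z := Complex.I) (by simp))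
  have h' : ∀ t, RCLike.re (pickKernel Complex.I t * (ν t : ℂ)) = 0 := fun t => by
    simp [pickKernel_I_re]
  simp only [h', integral_zero] at h
  exact h.symm

/-- The substitution `t = x + y s` makes the Poisson weight independent of `z`, so that range,
monotonicity and limits are inherited directly from `ν`. -/
lemma cauchyTransform_im (hν : IsPickDensity ν) {z : ℂ} (hz : 0 < z.im) :
    (cauchyTransform ν z).im = ∫ s : ℝ, (1 + s ^ 2)⁻¹ * ν (z.re + z.im * s) := by
  have h := integral_im (integrable_pickKernel_mul hν (z := z) hz.ne')
  have h' : ∀ t, RCLike.im (pickKernel z t * (ν t : ℂ)) =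
      z.im / ((t - z.re) ^ 2 + z.im ^ 2) * ν t := fun t => by
    simp [pickKernel_im]
  simp only [h'] at h
  have h2 := Measure.integral_comp_mul_left
    (fun t => z.im / ((z.re + t - z.re) ^ 2 + z.im ^ 2) * ν (z.re + t)) z.im
  have h3 := integral_add_left_eq_self (μ := volume)
    (fun t => z.im / ((t - z.re) ^ 2 + z.im ^ 2) * ν t) z.re
  rw [h3, h] at h2
  have h4 : ∀ s : ℝ, z.im / ((z.re + z.im * s - z.re) ^ 2 + z.im ^ 2) * ν (z.re + z.im * s) =
      z.im⁻¹ * ((1 + s ^ 2)⁻¹ * ν (z.re + z.im * s)) := fun s => by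
    have : (1 + s ^ 2) ≠ 0 := by positivity
    have h5 : (z.re + z.im * s - z.re) ^ 2 + z.im ^ 2 = z.im ^ 2 * (1 + s ^ 2) := by ring
    rw [h5]
    field_simp
  simp only [h4] at h2
  rw [integral_const_mul, abs_of_pos (inv_pos.2 hz), smul_eq_mul] at h2
  exact (mul_left_cancel₀ (inv_pos.2 hz).ne' h2).symm

lemma cauchyTransform_im_mem_Icc (hν : IsPickDensity ν) {z : ℂ} (hz : 0 < z.im) :
    (cauchyTransform ν z).im ∈ Icc 0 Real.pi := by
  rw [cauchyTransform_im hν hz]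
  constructor
  · exact integral_nonneg fun s => mul_nonneg (by positivity) (hν.2 _).1
  · rw [← integral_univ_inv_one_add_sq]
    refine integral_mono (hν.integrable_inv_one_add_sq_mul _ _) integrable_inv_one_add_sq
      fun s => ?_
    exact mul_le_of_le_one_right (by positivity) (hν.2 _).2

lemma cauchyTransform_im_mono (hν : IsPickDensity ν) {y : ℝ} (hy : 0 < y) :
    Monotone fun x : ℝ => (cauchyTransform ν (x + y * Complex.I)).im := by
  intro a b hab
  have h : ∀ x : ℝ, (cauchyTransform ν (x + y * Complex.I)).im =
      ∫ s : ℝ, (1 + s ^ 2)⁻¹ * ν (x + y * s) := fun x => by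
    rw [cauchyTransform_im hν (by simpa using hy)]
    simp
  simp only [h]
  refine integral_mono (hν.integrable_inv_one_add_sq_mul _ _)
    (hν.integrable_inv_one_add_sq_mul _ _) fun s => ?_
  exact mul_le_mul_of_nonneg_left (hν.1 (by linarith)) (by positivity)

/-- As `y ↓ 0`, `ν (x + y s)` tends to the right or left limit according to the sign of `s`, and
each half line carries half of the total weight `π`. -/
lemma tendsto_cauchyTransform_im (hν : IsPickDensity ν) (x : ℝ) :
    Tendsto (fun y : ℝ => (cauchyTransform ν (x + y * Complex.I)).im) (𝓝[>] 0)
      (𝓝 (Real.pi * ((Function.rightLim ν x + Function.leftLim ν x) / 2))) := by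
  set r := Function.rightLim ν x
  set l := Function.leftLim ν x
  have hr : Tendsto ν (𝓝[>] x) (𝓝 r) := hν.1.tendsto_rightLim x
  have hl : Tendsto ν (𝓝[<] x) (𝓝 l) := hν.1.tendsto_leftLim x
  have hlim : Tendsto (fun y : ℝ => ∫ s : ℝ, (1 + s ^ 2)⁻¹ * ν (x + y * s)) (𝓝[>] 0)
      (𝓝 (∫ s : ℝ, (1 + s ^ 2)⁻¹ * (if 0 < s then r else l))) := by
    refine tendsto_integral_filter_of_dominated_convergence (fun s => (1 + s ^ 2)⁻¹)
      (Eventually.of_forall fun y => (hν.integrable_inv_one_add_sq_mul x y).1)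
      (Eventually.of_forall fun y => Eventually.of_forall fun s => ?_)
      integrable_inv_one_add_sq ?_
    · rw [norm_mul, Real.norm_of_nonneg (by positivity)]
      exact mul_le_of_le_one_right (by positivity) (hν.norm_le_one _)
    · filter_upwards [compl_mem_ae_iff.2 (measure_singleton (0 : ℝ))] with s hs
      refine Tendsto.const_mul _ ?_
      have h0 : Tendsto (fun y : ℝ => x + y * s) (𝓝[>] 0) (𝓝 x) := by
        have : Continuous fun y : ℝ => x + y * s := by fun_prop
        exact (this.tendsto' 0 x (by simp)).mono_left nhdsWithin_le_nhds
      rcases lt_or_gt_of_ne (show s ≠ 0 from hs) with hs | hs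
      · rw [if_neg hs.not_gt]
        refine hl.comp (tendsto_nhdsWithin_iff.2 ⟨h0, ?_⟩)
        filter_upwards [self_mem_nhdsWithin] with y hy
        have := mul_neg_of_pos_of_neg (show 0 < y from hy) hs
        simp only [mem_Iio]
        linarith
      · rw [if_pos hs]
        refine hr.comp (tendsto_nhdsWithin_iff.2 ⟨h0, ?_⟩)
        filter_upwards [self_mem_nhdsWithin] with y hy
        have := mul_pos (show 0 < y from hy) hs
        simp only [mem_Ioi]
        linarith
  have hval : ∫ s : ℝ, (1 + s ^ 2)⁻¹ * (if 0 < s then r else l) = Real.pi * ((r + l) / 2) := by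
    have h1 : (fun s : ℝ => (1 + s ^ 2)⁻¹ * (if 0 < s then r else l)) = fun s =>
        (Ioi 0).indicator (fun s : ℝ => (1 + s ^ 2)⁻¹ * r) s +
        (Ioi 0)ᶜ.indicator (fun s : ℝ => (1 + s ^ 2)⁻¹ * l) s := by
      ext s
      by_cases hs : 0 < s <;> simp [hs, indicator]
    have hi := integrable_inv_one_add_sq
    rw [h1, integral_add ((hi.mul_const r).indicator measurableSet_Ioi)
      ((hi.mul_const l).indicator measurableSet_Ioi.compl), integral_indicator measurableSet_Ioi,
      integral_indicator measurableSet_Ioi.compl, compl_Ioi, integral_mul_const,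
      integral_mul_const, integral_Ioi_inv_one_add_sq, integral_Iic_inv_one_add_sq]
    simp
    ring
  rw [hval] at hlim
  refine hlim.congr' ?_
  filter_upwards [self_mem_nhdsWithin] with y hy
  rw [cauchyTransform_im hν (by simpa using hy)]
  simp

end

/-! ### Description of the class by the imaginary parts of `f` and `f'` -/

lemma isOpen_im_pos : IsOpen {z : ℂ | 0 < z.im} :=
  isOpen_lt continuous_const Complex.continuous_im

lemma isPreconnected_im_pos : IsPreconnected {z : ℂ | 0 < z.im} :=
  (convex_halfSpace_im_gt 0).isPreconnected

lemma differentiableAt_of_im_ne_zero {f : ℂ → ℂ} (hf : DifferentiableOn ℂ f {z : ℂ | z.im ≠ 0})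
    {z : ℂ} (hz : z.im ≠ 0) : DifferentiableAt ℂ f z :=
  (hf z hz).differentiableAt (isOpen_im_ne_zero.mem_nhds hz)

/-- `f` is holomorphic off the real line, symmetric, and in the upper half plane `Im f` lies
in `[0, π]` and `Im f'` is nonnegative. -/
structure IsStripPrimitive (f : ℂ → ℂ) : Prop where
  differentiableOn : DifferentiableOn ℂ f {z : ℂ | z.im ≠ 0}
  symm : ∀ z : ℂ, z.im < 0 → f z = conj (f (conj z))
  im_mem : ∀ z : ℂ, 0 < z.im → (f z).im ∈ Icc 0 Real.pi
  deriv_im_nonneg : ∀ z : ℂ, 0 < z.im → 0 ≤ (deriv f z).im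

lemma deriv_eq_conj_of_symm {f : ℂ → ℂ} (hf : ∀ z : ℂ, z.im < 0 → f z = conj (f (conj z)))
    {z : ℂ} (hz : z.im < 0) : deriv f z = conj (deriv f (conj z)) := by
  have h : f =ᶠ[𝓝 z] conj ∘ f ∘ conj := by
    filter_upwards [(isOpen_lt Complex.continuous_im continuous_const).mem_nhds hz] with w hw
      using hf w hw
  rw [h.deriv_eq, deriv_conj_conj]
  rfl

lemma IsStripPrimitive.mem_primPickClass {f : ℂ → ℂ} (hf : IsStripPrimitive f) :
    f ∈ PrimPickClass := by
  refine ⟨hf.differentiableOn, ⟨hf.differentiableOn.deriv isOpen_im_ne_zero, fun z hz => ?_,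
    fun z hz => deriv_eq_conj_of_symm hf.symm hz⟩, ?_⟩
  · rcases lt_or_gt_of_ne hz with hz | hz
    · refine div_nonneg_of_nonpos ?_ hz.le
      rw [deriv_eq_conj_of_symm hf.symm hz, Complex.conj_im, neg_nonpos]
      exact hf.deriv_im_nonneg _ (by simpa using hz)
    · exact div_nonneg (hf.deriv_im_nonneg z hz) hz.le
  · simpa using hf.symm (-Complex.I) (by simp)

lemma IsStripPrimitive.mem_logPickClass {f : ℂ → ℂ} (hf : IsStripPrimitive f) :
    f ∈ LogPickClass := by
  have hpos : ∀ z : ℂ, 0 < z.im → 0 ≤ (Complex.exp (f z)).im := fun z hz => by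
    rw [Complex.exp_im]
    exact mul_nonneg (Real.exp_pos _).le
      (Real.sin_nonneg_of_nonneg_of_le_pi (hf.im_mem z hz).1 (hf.im_mem z hz).2)
  have hsymm : ∀ z : ℂ, z.im < 0 → Complex.exp (f z) = conj (Complex.exp (f (conj z))) :=
    fun z hz => by rw [hf.symm z hz, Complex.exp_conj]
  refine ⟨fun z => Complex.exp (f z), ⟨hf.differentiableOn.cexp, fun z hz => ?_, hsymm⟩,
    ⟨Complex.I, by simp, Complex.exp_ne_zero _⟩, fun z hz => ?_, hf.symm⟩
  · rcases lt_or_gt_of_ne hz with hz | hz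
    · refine div_nonneg_of_nonpos ?_ hz.le
      change (Complex.exp (f z)).im ≤ 0
      rw [hsymm z hz, Complex.conj_im, neg_nonpos]
      exact hpos _ (by simpa using hz)
    · exact div_nonneg (hpos z hz) hz.le
  · rw [Complex.log_exp (by linarith [(hf.im_mem z hz).1, Real.pi_pos]) (hf.im_mem z hz).2]

lemma mem_primPickClass_inter_logPickClass_iff {f : ℂ → ℂ} :
    f ∈ PrimPickClass ∩ LogPickClass ↔ IsStripPrimitive f := by
  refine ⟨?_, fun hf => ⟨hf.mem_primPickClass, hf.mem_logPickClass⟩⟩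
  rintro ⟨⟨hd, hf', -⟩, Φ, hΦ, -, hlog, hsymm⟩
  refine ⟨hd, hsymm, fun z hz => ?_, fun z hz => ?_⟩
  -- The imaginary part is `arg Φ`. Zeros of `Φ` cause no trouble, as `arg 0 = 0`.
  · rw [hlog z hz, Complex.log_im]
    refine ⟨Complex.arg_nonneg_iff.2 ?_, Complex.arg_le_pi _⟩
    have := mul_nonneg (hΦ.2.1 z hz.ne') hz.le
    rwa [div_mul_cancel₀ _ hz.ne'] at this
  · have := mul_nonneg (hf'.2.1 z hz.ne') hz.le
    rwa [div_mul_cancel₀ _ hz.ne'] at this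

/-! ### Monotonicity of the imaginary part along horizontal lines -/

/-- The link between `Im f' ≥ 0` and monotonicity of `Im f` in `x`, used in both directions. -/
lemma hasDerivAt_im_comp_horizontal {f : ℂ → ℂ} {x y : ℝ}
    (hf : DifferentiableAt ℂ f (x + y * Complex.I)) :
    HasDerivAt (fun u : ℝ => (f (u + y * Complex.I)).im) (deriv f (x + y * Complex.I)).im x := by
  have h1 : HasDerivAt (fun u : ℝ => (u : ℂ) + y * Complex.I) 1 x :=
    Complex.ofRealCLM.hasDerivAt.add_const _
  have h2 := HasDerivAt.scomp (𝕜 := ℝ) (𝕜' := ℂ) x hf.hasDerivAt h1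
  have h3 := Complex.imCLM.hasFDerivAt.comp_hasDerivAt x h2
  exact h3.congr_deriv (by simp)

lemma IsStripPrimitive.im_mono {f : ℂ → ℂ} (hf : IsStripPrimitive f) {y : ℝ} (hy : 0 < y) :
    Monotone fun x : ℝ => (f (x + y * Complex.I)).im := by
  have h : ∀ x : ℝ, HasDerivAt (fun u : ℝ => (f (u + y * Complex.I)).im)
      (deriv f (x + y * Complex.I)).im x := fun x => hasDerivAt_im_comp_horizontal
    (differentiableAt_of_im_ne_zero hf.differentiableOn (by simpa using hy.ne'))
  refine monotone_of_deriv_nonneg (fun x => (h x).differentiableAt) fun x => ?_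
  rw [(h x).deriv]
  exact hf.deriv_im_nonneg _ (by simpa using hy)

lemma deriv_im_nonneg_of_im_mono {f : ℂ → ℂ} {z : ℂ} (hf : DifferentiableAt ℂ f z)
    (hmono : Monotone fun x : ℝ => (f (x + z.im * Complex.I)).im) : 0 ≤ (deriv f z).im := by
  rw [← Complex.re_add_im z] at hf
  have h := hasDerivAt_im_comp_horizontal hf
  rw [Complex.re_add_im] at h
  rw [← h.deriv]
  exact hmono.deriv_nonneg

lemma HasCauchyForm.isStripPrimitive {f : ℂ → ℂ} {β : ℝ} {ν : ℝ → ℝ} (hν : IsPickDensity ν)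
    (hf : HasCauchyForm f β ν) : IsStripPrimitive f := by
  rw [hasCauchyForm_iff] at hf
  have hd : DifferentiableOn ℂ f {z : ℂ | z.im ≠ 0} :=
    ((differentiableOn_cauchyTransform hν).const_add (β : ℂ)).congr fun z hz => hf z hz
  refine ⟨hd, fun z hz => ?_, fun z hz => ?_, fun z hz => ?_⟩
  · rw [hf z hz.ne, hf (conj z) (by simpa using hz.ne), cauchyTransform_conj]
    simp
  · rw [hf z hz.ne']
    simpa using cauchyTransform_im_mem_Icc hν hz
  · refine deriv_im_nonneg_of_im_mono (differentiableAt_of_im_ne_zero hd hz.ne') ?_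
    have h : ∀ x : ℝ, (f (x + z.im * Complex.I)).im =
        (cauchyTransform ν (x + z.im * Complex.I)).im := fun x => by
      rw [hf _ (by simpa using hz.ne')]
      simp
    simpa only [h] using cauchyTransform_im_mono hν hz

/-! ### Strict positivity -/

/-- A holomorphic function with nonnegative imaginary part in the upper half plane is constant
if its imaginary part has a zero. -/
lemma isConstOnUpper_of_im_eq_zero {g : ℂ → ℂ} (hg : DifferentiableOn ℂ g {z : ℂ | 0 < z.im})
    (hnonneg : ∀ z : ℂ, 0 < z.im → 0 ≤ (g z).im) {z₀ : ℂ} (hz₀ : 0 < z₀.im)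
    (h0 : (g z₀).im = 0) : IsConstOnUpper g := by
  rcases (hg.analyticOnNhd isOpen_im_pos).is_constant_or_isOpen isPreconnected_im_pos with h | h
  · exact h
  · have ho := h _ Subset.rfl isOpen_im_pos
    -- An open image would contain points just below `g z₀`, where the imaginary part is negative.
    have hmem : ∀ᶠ ε : ℝ in 𝓝[>] 0, g z₀ - ε * Complex.I ∈ g '' {z : ℂ | 0 < z.im} := by
      have hc : Continuous fun ε : ℝ => g z₀ - ε * Complex.I := by fun_prop
      exact ((hc.tendsto' 0 (g z₀) (by simp)).mono_left nhdsWithin_le_nhds).eventually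
        (ho.mem_nhds ⟨z₀, hz₀, rfl⟩)
    obtain ⟨ε, ⟨w, hw, hwe⟩, hε⟩ := (hmem.and self_mem_nhdsWithin).exists
    have := hnonneg w hw
    rw [hwe] at this
    simp [h0] at this
    exact absurd hε (not_lt.2 this)

/-- Here `f = c z + d` with `c` real, and `Im f = c y + Im d` stays in `[0, π]` for all `y > 0` only
if `c = 0`. -/
lemma IsStripPrimitive.isConstOnUpper_of_deriv {f : ℂ → ℂ} (hf : IsStripPrimitive f) {c : ℂ}
    (hc : c.im = 0) (h : ∀ z : ℂ, 0 < z.im → deriv f z = c) : IsConstOnUpper f := by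
  have hd : DifferentiableOn ℂ f {z : ℂ | 0 < z.im} :=
    hf.differentiableOn.mono fun z hz => ne_of_gt hz
  obtain ⟨d, hfd⟩ : ∃ d : ℂ, ∀ z : ℂ, 0 < z.im → f z - c * z = d := by
    obtain ⟨d, hd'⟩ := isOpen_im_pos.exists_is_const_of_deriv_eq_zero isPreconnected_im_pos
      (f := fun z => f z - c * z) (hd.sub (by fun_prop)) fun z hz => by
        have h1 := (differentiableAt_of_im_ne_zero hf.differentiableOn (ne_of_gt hz)).hasDerivAt
        have h2 := h1.sub ((hasDerivAt_id z).const_mul c)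
        have h3 : deriv (fun z => f z - c * z) z = _ := h2.deriv
        rw [h z hz] at h3
        simpa using h3
    exact ⟨d, hd'⟩
  have hcre : c = (c.re : ℂ) := by
    apply Complex.ext <;> simp [hc]
  have him : ∀ y : ℝ, 0 < y → c.re * y + d.im ∈ Icc 0 Real.pi := fun y hy => by
    have h1 : f (y * Complex.I) = c.re * (y * Complex.I) + d := by
      rw [← hfd (y * Complex.I) (by simpa using hy), ← hcre]
      ring
    have h2 := hf.im_mem (y * Complex.I) (by simpa using hy)
    rw [h1] at h2
    simpa using h2
  have hc0 : c.re = 0 := by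
    by_contra hne
    have hpos : 0 < |c.re| := abs_pos.2 hne
    have hpi := Real.pi_pos
    -- At this height `|c| y` exceeds `π + |Im d|`, so `c y + Im d` is above `π` or below `0`.
    set y : ℝ := (Real.pi + 1 + |d.im|) / |c.re|
    have hy : 0 < y := by positivity
    have h1 := him y hy
    have h3 : |c.re| * y = Real.pi + 1 + |d.im| := mul_div_cancel₀ _ hpos.ne'
    have h4 := neg_abs_le d.im
    have h5 := le_abs_self d.im
    rcases abs_cases c.re with ⟨h6, -⟩ | ⟨h6, -⟩
    · rw [h6] at h3
      linarith [h1.2]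
    · rw [h6] at h3
      linarith [h1.1]
  refine ⟨d, fun z hz => ?_⟩
  have := hfd z hz
  rwa [hcre, hc0, Complex.ofReal_zero, zero_mul, sub_zero] at this

lemma IsStripPrimitive.im_pos {f : ℂ → ℂ} (hf : IsStripPrimitive f) (hc : ¬ IsConstOnUpper f)
    {z : ℂ} (hz : 0 < z.im) : 0 < (f z).im := by
  refine lt_of_le_of_ne (hf.im_mem z hz).1 fun h => hc ?_
  exact isConstOnUpper_of_im_eq_zero (hf.differentiableOn.mono fun z hz => ne_of_gt hz)
    (fun z hz => (hf.im_mem z hz).1) hz h.symm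

lemma IsStripPrimitive.deriv_im_pos {f : ℂ → ℂ} (hf : IsStripPrimitive f)
    (hc : ¬ IsConstOnUpper f) {z : ℂ} (hz : 0 < z.im) : 0 < (deriv f z).im := by
  refine lt_of_le_of_ne (hf.deriv_im_nonneg z hz) fun h => hc ?_
  obtain ⟨c, hc⟩ := isConstOnUpper_of_im_eq_zero
    ((hf.differentiableOn.deriv isOpen_im_ne_zero).mono fun z hz => ne_of_gt hz)
    hf.deriv_im_nonneg hz h.symm
  exact hf.isConstOnUpper_of_deriv (by rw [← hc z hz, ← h]) hc

/-! ### The logarithmic kernel -/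

lemma sqrt_one_add_sq_pos (t : ℝ) : 0 < Real.sqrt (1 + t ^ 2) :=
  Real.sqrt_pos.2 (by positivity)

/-- Keeps the argument of the logarithm off the branch cut, and above it in the limit `t → -∞`. -/
lemma im_sqrt_div_sub_pos {z : ℂ} (hz : 0 < z.im) (t : ℝ) :
    0 < ((Real.sqrt (1 + t ^ 2) : ℂ) / ((t : ℂ) - z)).im := by
  have h := ofReal_sub_ne_zero_of_im_ne_zero hz.ne' t
  rw [div_eq_mul_inv, Complex.im_ofReal_mul, Complex.inv_im]
  refine mul_pos (sqrt_one_add_sq_pos t) (div_pos ?_ (Complex.normSq_pos.2 h))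
  simpa using hz

lemma hasDerivAt_logKernel {z : ℂ} (hz : 0 < z.im) (t : ℝ) :
    HasDerivAt (logKernel z) (-pickKernel z t) t := by
  have h0 := ofReal_sub_ne_zero_of_im_ne_zero hz.ne' t
  have hs := sqrt_one_add_sq_pos t
  have hs2 : Real.sqrt (1 + t ^ 2) ^ 2 = 1 + t ^ 2 := Real.sq_sqrt (by positivity)
  have h1 : HasDerivAt (fun t : ℝ => Real.sqrt (1 + t ^ 2)) (t / Real.sqrt (1 + t ^ 2)) t := by
    have h := ((hasDerivAt_pow 2 t).const_add 1).sqrt (by positivity)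
    convert h using 1
    field_simp
    simp [mul_comm]
  have h2 : HasDerivAt (fun t : ℝ => (t : ℂ) - z) 1 t :=
    Complex.ofRealCLM.hasDerivAt.sub_const _
  have h3 := (h1.ofReal_comp.div h2 h0).clog_real (Or.inr (im_sqrt_div_sub_pos hz t).ne')
  refine h3.congr_deriv ?_
  have hsc : (Real.sqrt (1 + t ^ 2) : ℂ) ≠ 0 := by exact_mod_cast hs.ne'
  have hs2c : (1 : ℂ) + (t : ℂ) ^ 2 = (Real.sqrt (1 + t ^ 2) : ℂ) ^ 2 := by
    exact_mod_cast hs2.symm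
  simp only [pickKernel, Pi.div_apply]
  rw [hs2c]
  push_cast
  field_simp
  ring

lemma continuous_logKernel {z : ℂ} (hz : 0 < z.im) : Continuous (logKernel z) :=
  continuous_iff_continuousAt.2 fun t => (hasDerivAt_logKernel hz t).continuousAt

lemma tendsto_sqrt_inv_sq_div (z : ℂ) :
    Tendsto (fun u : ℝ => (Real.sqrt (u ^ 2 + 1) : ℂ) / (1 - z * u)) (𝓝 0) (𝓝 1) := by
  have h1 : ContinuousAt (fun u : ℝ => (Real.sqrt (u ^ 2 + 1) : ℂ) / (1 - z * u)) 0 :=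
    ContinuousAt.div (by fun_prop) (by fun_prop) (by simp)
  simpa [ContinuousAt] using h1

lemma sqrt_one_add_sq_eq_abs_mul {t : ℝ} (ht : t ≠ 0) :
    Real.sqrt (1 + t ^ 2) = |t| * Real.sqrt (t⁻¹ ^ 2 + 1) := by
  rw [← Real.sqrt_sq_eq_abs, ← Real.sqrt_mul (sq_nonneg t)]
  congr 1
  field_simp

lemma tendsto_logKernel_atTop (z : ℂ) : Tendsto (logKernel z) atTop (𝓝 0) := by
  have h1 : Tendsto (fun t : ℝ => (Real.sqrt (1 + t ^ 2) : ℂ) / ((t : ℂ) - z)) atTop (𝓝 1) := by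
    refine ((tendsto_sqrt_inv_sq_div z).comp tendsto_inv_atTop_zero).congr' ?_
    filter_upwards [eventually_gt_atTop 0] with t ht
    have htc : (t : ℂ) ≠ 0 := by exact_mod_cast ht.ne'
    have h2 : (t : ℂ) - z = t * (1 - z * ((t⁻¹ : ℝ) : ℂ)) := by
      push_cast
      field_simp
    rw [sqrt_one_add_sq_eq_abs_mul ht.ne', abs_of_pos ht, h2, Complex.ofReal_mul,
      mul_div_mul_left _ _ htc]
    rfl
  have h2 := h1.clog (by simp)
  rwa [Complex.log_one] at h2

lemma tendsto_logKernel_atBot {z : ℂ} (hz : 0 < z.im) :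
    Tendsto (logKernel z) atBot (𝓝 (Real.pi * Complex.I)) := by
  have h1 : Tendsto (fun t : ℝ => (Real.sqrt (1 + t ^ 2) : ℂ) / ((t : ℂ) - z)) atBot
      (𝓝 (-1)) := by
    refine ((tendsto_sqrt_inv_sq_div z).neg.comp tendsto_inv_atBot_zero).congr' ?_
    filter_upwards [eventually_lt_atBot 0] with t ht
    have htc : (t : ℂ) ≠ 0 := by exact_mod_cast ht.ne
    have h2 : (t : ℂ) - z = t * (1 - z * ((t⁻¹ : ℝ) : ℂ)) := by
      push_cast
      field_simp
    rw [sqrt_one_add_sq_eq_abs_mul ht.ne, abs_of_neg ht, h2, Complex.ofReal_mul,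
      Complex.ofReal_neg, neg_mul, neg_div, mul_div_mul_left _ _ htc]
    rfl
  -- The limit `-1` lies on the cut; the logarithm is continuous there only from the closed upper
  -- side, where its value is `π i`.
  have h3 := (Complex.continuousWithinAt_log_of_re_neg_of_im_zero (z := -1) (by simp) (by simp))
  have h4 : Tendsto (fun t : ℝ => (Real.sqrt (1 + t ^ 2) : ℂ) / ((t : ℂ) - z)) atBot
      (𝓝[{z : ℂ | 0 ≤ z.im}] (-1)) :=
    tendsto_nhdsWithin_iff.2 ⟨h1, Eventually.of_forall fun t => (im_sqrt_div_sub_pos hz t).le⟩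
  have h5 := h3.tendsto.comp h4
  rwa [Complex.log_neg_one] at h5

lemma integral_Ici_pickKernel {z : ℂ} (hz : 0 < z.im) (t : ℝ) :
    ∫ s in Ici t, pickKernel z s = logKernel z t := by
  have h := integral_Ioi_of_hasDerivAt_of_tendsto' (a := t)
    (fun s _ => hasDerivAt_logKernel hz s) (integrable_pickKernel hz.ne').neg.integrableOn
    (tendsto_logKernel_atTop z)
  rw [integral_neg, zero_sub, neg_inj] at h
  rw [integral_Ici_eq_integral_Ioi, h]

lemma integral_pickKernel {z : ℂ} (hz : 0 < z.im) :
    ∫ s, pickKernel z s = Complex.I * Real.pi := by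
  have h := integral_of_hasDerivAt_of_tendsto (hasDerivAt_logKernel hz)
    (integrable_pickKernel hz.ne').neg (tendsto_logKernel_atBot hz) (tendsto_logKernel_atTop z)
  rw [integral_neg, zero_sub, neg_inj] at h
  rw [h, mul_comm]

lemma norm_logKernel_le {z : ℂ} (hz : 0 < z.im) (t : ℝ) :
    ‖logKernel z t‖ ≤ ∫ s, ‖pickKernel z s‖ := by
  rw [← integral_Ici_pickKernel hz]
  exact (norm_integral_le_integral_norm _).trans (setIntegral_le_integral
    (integrable_pickKernel hz.ne').norm (Eventually.of_forall fun s => norm_nonneg _))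

/-! ### The Lebesgue-Stieltjes measure of a density -/

namespace IsPickDensity

variable {ν : ℝ → ℝ}

lemma rightLim_mem_Icc (hν : IsPickDensity ν) (x : ℝ) : Function.rightLim ν x ∈ Icc (0 : ℝ) 1 :=
  ⟨(hν.2 x).1.trans (hν.1.le_rightLim le_rfl),
    (hν.1.rightLim_le (lt_add_one x)).trans (hν.2 _).2⟩

lemma isFiniteMeasure_lsMeasure (hν : IsPickDensity ν) : IsFiniteMeasure (lsMeasure ν hν.1) := by
  refine StieltjesFunction.isFiniteMeasure_of_forall_abs_le (C := 1) _ fun x => ?_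
  rw [Monotone.stieltjesFunction_eq, abs_of_nonneg (hν.rightLim_mem_Icc x).1]
  exact (hν.rightLim_mem_Icc x).2

lemma tendsto_atBot (hν : IsPickDensity ν) : Tendsto ν atBot (𝓝 (limUnder atBot ν)) := by
  have h := tendsto_atBot_ciInf hν.1 ⟨0, by rintro _ ⟨x, rfl⟩; exact (hν.2 x).1⟩
  rwa [h.limUnder_eq]

lemma limUnder_atBot_le (hν : IsPickDensity ν) (x : ℝ) : limUnder atBot ν ≤ ν x :=
  hν.1.le_of_tendsto hν.tendsto_atBot x

lemma rightLim_tendsto_atBot (hν : IsPickDensity ν) :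
    Tendsto (Function.rightLim ν) atBot (𝓝 (limUnder atBot ν)) :=
  tendsto_of_tendsto_of_tendsto_of_le_of_le hν.tendsto_atBot
    (hν.tendsto_atBot.comp (tendsto_atBot_add_const_right _ 1 tendsto_id))
    (fun _ => hν.1.le_rightLim le_rfl) (fun x => hν.1.rightLim_le (lt_add_one x))

lemma lsMeasure_Iic (hν : IsPickDensity ν) (x : ℝ) :
    lsMeasure ν hν.1 (Iic x) = ENNReal.ofReal (Function.rightLim ν x - limUnder atBot ν) := by
  have h := StieltjesFunction.measure_Iic hν.1.stieltjesFunction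
    (l := limUnder atBot ν) hν.rightLim_tendsto_atBot x
  rwa [Monotone.stieltjesFunction_eq] at h

lemma ae_continuousAt (hν : IsPickDensity ν) : ∀ᵐ x : ℝ, ContinuousAt ν x :=
  (hν.1.countable_not_continuousAt.ae_notMem volume).mono fun _ hx => not_not.1 hx

lemma lsMeasure_real_Iic (hν : IsPickDensity ν) {x : ℝ} (hx : ContinuousAt ν x) :
    (lsMeasure ν hν.1).real (Iic x) = ν x - limUnder atBot ν := by
  rw [Measure.real, hν.lsMeasure_Iic,
    hν.1.continuousWithinAt_Ioi_iff_rightLim_eq.1 hx.continuousWithinAt,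
    ENNReal.toReal_ofReal (sub_nonneg.2 (hν.limUnder_atBot_le x))]

lemma lsMeasure_singleton (hν : IsPickDensity ν) {x : ℝ} (hx : ContinuousAt ν x) :
    lsMeasure ν hν.1 {x} = 0 := by
  rw [lsMeasure, StieltjesFunction.measure_singleton, Monotone.stieltjesFunction_eq,
    ENNReal.ofReal_eq_zero, sub_nonpos]
  have h1 : Function.rightLim ν x = Function.leftLim ν x :=
    (hν.1.continuousAt_iff_leftLim_eq_rightLim.1 hx).symm
  have hl := hν.1.tendsto_leftLim x
  have h2 : Tendsto hν.1.stieltjesFunction (𝓝[<] x)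
      (𝓝 (Function.leftLim hν.1.stieltjesFunction x)) :=
    hν.1.stieltjesFunction.mono.tendsto_leftLim x
  rw [h1]
  -- The Stieltjes function is `ν(· + 0) ≥ ν`, so its left limit at `x` is at least that of `ν`,
  -- which by continuity equals `ν(x + 0)`.
  refine le_of_tendsto_of_tendsto hl h2 (Eventually.of_forall fun y => ?_)
  rw [Monotone.stieltjesFunction_eq]
  exact hν.1.le_rightLim le_rfl

end IsPickDensity

/-! ### Equivalence of the Cauchy form and the logarithmic form -/

section

variable {ν : ℝ → ℝ}

lemma integrable_logKernel (hν : IsPickDensity ν) {z : ℂ} (hz : 0 < z.im) :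
    Integrable (logKernel z) (lsMeasure ν hν.1) := by
  have := hν.isFiniteMeasure_lsMeasure
  exact Integrable.of_bound (continuous_logKernel hz).aestronglyMeasurable _
    (Eventually.of_forall (norm_logKernel_le hz))

/-- Fubini on the region `t ≤ s`: integrating in `s` first gives `logKernel z t`, integrating in `t`
first gives the mass of `(-∞, s]`, which is `ν s - ν(-∞)` off the countably many jumps. -/
lemma integral_logKernel (hν : IsPickDensity ν) {z : ℂ} (hz : 0 < z.im) :
    ∫ t, logKernel z t ∂(lsMeasure ν hν.1) =
      ∫ s, pickKernel z s * ((ν s - limUnder atBot ν : ℝ) : ℂ) := by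
  have := hν.isFiniteMeasure_lsMeasure
  set μ := lsMeasure ν hν.1
  have hk := integrable_pickKernel hz.ne'
  have hm : MeasurableSet {p : ℝ × ℝ | p.1 ≤ p.2} := measurableSet_le measurable_fst measurable_snd
  have hprod : Integrable ({p : ℝ × ℝ | p.1 ≤ p.2}.indicator fun p => pickKernel z p.2)
      (μ.prod volume) := (hk.comp_snd μ).indicator hm
  have hswap := integral_integral_swap (f := fun t s : ℝ =>
    {p : ℝ × ℝ | p.1 ≤ p.2}.indicator (fun p => pickKernel z p.2) (t, s)) hprod
  have h1 : ∀ t : ℝ, ∫ s, {p : ℝ × ℝ | p.1 ≤ p.2}.indicator (fun p => pickKernel z p.2) (t, s) =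
      logKernel z t := fun t => by
    rw [← integral_Ici_pickKernel hz, ← integral_indicator measurableSet_Ici]
    rfl
  have h2 : ∀ s : ℝ, ∫ t, {p : ℝ × ℝ | p.1 ≤ p.2}.indicator (fun p => pickKernel z p.2) (t, s) ∂μ =
      (μ.real (Iic s) : ℂ) * pickKernel z s := fun s => by
    have : (fun t : ℝ => {p : ℝ × ℝ | p.1 ≤ p.2}.indicator (fun p => pickKernel z p.2) (t, s)) =
        (Iic s).indicator fun _ => pickKernel z s := rfl
    rw [this, integral_indicator_const _ measurableSet_Iic, Complex.real_smul]
  simp only [h1, h2] at hswap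
  rw [hswap]
  refine integral_congr_ae ?_
  filter_upwards [hν.ae_continuousAt] with s hs
  rw [hν.lsMeasure_real_Iic hs, mul_comm]

/-- The constant `ν(-∞)` missing from the integration by parts contributes `ν(-∞)` times the total
integral `iπ` of the kernel. -/
lemma cauchyTransform_eq_logIntegral (hν : IsPickDensity ν) {z : ℂ} (hz : 0 < z.im) :
    cauchyTransform ν z = Complex.I * (Real.pi : ℂ) * ((limUnder atBot ν : ℝ) : ℂ) +
      ∫ t, logKernel z t ∂(lsMeasure ν hν.1) := by
  have h : ∀ s, pickKernel z s * ((ν s - limUnder atBot ν : ℝ) : ℂ) =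
      pickKernel z s * (ν s : ℂ) - pickKernel z s * ((limUnder atBot ν : ℝ) : ℂ) := fun s => by
    push_cast
    ring
  rw [integral_logKernel hν hz]
  simp only [h]
  rw [integral_sub (integrable_pickKernel_mul hν hz.ne')
    ((integrable_pickKernel hz.ne').mul_const _), integral_mul_const, integral_pickKernel hz,
    cauchyTransform]
  ring

lemma hasCauchyForm_iff_hasLogForm (f : ℂ → ℂ) (β : ℝ) (hν : IsPickDensity ν) :
    HasCauchyForm f β ν ↔ HasLogForm f β ν hν.1 := by
  constructor
  · intro hf
    refine ⟨fun z hz => ?_, (hf.isStripPrimitive hν).symm⟩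
    rw [hasCauchyForm_iff.1 hf z hz.ne', cauchyTransform_eq_logIntegral hν hz, add_assoc]
  · rintro ⟨h1, h2⟩
    have h3 : ∀ z : ℂ, 0 < z.im → f z = β + cauchyTransform ν z := fun z hz => by
      rw [h1 z hz, cauchyTransform_eq_logIntegral hν hz, add_assoc]
    refine hasCauchyForm_iff.2 fun z hz => ?_
    rcases lt_or_gt_of_ne hz with hz | hz
    · rw [h2 z hz, h3 _ (by simpa using hz), cauchyTransform_conj]
      simp
    · exact h3 z hz

end

/-! ### Uniqueness and constancy -/

section

variable {f : ℂ → ℂ} {β : ℝ} {ν : ℝ → ℝ}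

lemma HasCauchyForm.re_I (hf : HasCauchyForm f β ν) (hν : IsPickDensity ν) :
    (f Complex.I).re = β := by
  rw [hasCauchyForm_iff.1 hf _ (by simp), Complex.add_re, cauchyTransform_I_re hν]
  simp

lemma HasCauchyForm.tendsto_im (hf : HasCauchyForm f β ν) (hν : IsPickDensity ν) (x : ℝ) :
    Tendsto (fun y : ℝ => (f ((x : ℂ) + (y : ℂ) * Complex.I)).im) (𝓝[>] 0)
      (𝓝 (Real.pi * ((Function.rightLim ν x + Function.leftLim ν x) / 2))) := by
  refine (tendsto_cauchyTransform_im hν x).congr' ?_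
  filter_upwards [self_mem_nhdsWithin] with y hy
  rw [hasCauchyForm_iff.1 hf _ (by simpa using (ne_of_gt hy : y ≠ 0))]
  simp

lemma HasCauchyForm.iff_of_hasCauchyForm {β₁ β₂ : ℝ} {ν₁ ν₂ : ℝ → ℝ} (hν₁ : IsPickDensity ν₁)
    (hν₂ : IsPickDensity ν₂) (h₁ : HasCauchyForm f β₁ ν₁) :
    HasCauchyForm f β₂ ν₂ ↔ β₁ = β₂ ∧ ν₁ =ᵐ[volume] ν₂ := by
  constructor
  · intro h₂
    refine ⟨by rw [← h₁.re_I hν₁, h₂.re_I hν₂], ?_⟩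
    filter_upwards [hν₁.ae_continuousAt, hν₂.ae_continuousAt] with x hx₁ hx₂
    have h := tendsto_nhds_unique (h₁.tendsto_im hν₁ x) (h₂.tendsto_im hν₂ x)
    rw [hν₁.1.continuousWithinAt_Ioi_iff_rightLim_eq.1 hx₁.continuousWithinAt,
      hν₂.1.continuousWithinAt_Ioi_iff_rightLim_eq.1 hx₂.continuousWithinAt,
      hν₁.1.continuousWithinAt_Iio_iff_leftLim_eq.1 hx₁.continuousWithinAt,
      hν₂.1.continuousWithinAt_Iio_iff_leftLim_eq.1 hx₂.continuousWithinAt] at h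
    have := mul_left_cancel₀ Real.pi_ne_zero h
    linarith
  · rintro ⟨rfl, h⟩ z hz
    rw [h₁ z hz]
    congr 1
    refine integral_congr_ae ?_
    filter_upwards [h] with t ht
    rw [ht]

lemma HasCauchyForm.eq_of_const (hf : HasCauchyForm f β ν) {θ : ℝ} (hθ : ∀ x, ν x = θ) {z : ℂ}
    (hz : 0 < z.im) : f z = (β : ℂ) + Complex.I * (Real.pi : ℂ) * (θ : ℂ) := by
  rw [hf z hz.ne']
  simp only [hθ]
  rw [integral_mul_const, integral_pickKernel hz]

lemma HasCauchyForm.exists_const (hf : HasCauchyForm f β ν) (hν : IsPickDensity ν)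
    (hc : IsConstOnUpper f) : ∃ θ : ℝ, ∀ x, ν x = θ := by
  obtain ⟨c, hc⟩ := hc
  have key : ∀ x, (Function.rightLim ν x + Function.leftLim ν x) / 2 = c.im / Real.pi := fun x => by
    have h : Tendsto (fun y : ℝ => (f ((x : ℂ) + (y : ℂ) * Complex.I)).im) (𝓝[>] 0)
        (𝓝 c.im) := by
      refine tendsto_const_nhds.congr' ?_
      filter_upwards [self_mem_nhdsWithin] with y hy
      rw [hc _ (by simpa using hy)]
    rw [tendsto_nhds_unique h (hf.tendsto_im hν x), mul_div_cancel_left₀ _ Real.pi_ne_zero]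
  -- All midpoints agree; `ν x` lies between the midpoints at `x - 1` and `x + 1`. This gives
  -- constancy everywhere, not only almost everywhere.
  refine ⟨c.im / Real.pi, fun x => le_antisymm ?_ ?_⟩
  · have h1 := hν.1.le_leftLim (lt_add_one x)
    have h2 := hν.1.le_rightLim (lt_add_one x).le
    rw [← key (x + 1)]
    linarith
  · have h1 := hν.1.leftLim_le (sub_one_lt x).le
    have h2 := hν.1.rightLim_le (sub_one_lt x)
    rw [← key (x - 1)]
    linarith

lemma HasCauchyForm.isConstOnUpper_iff (hf : HasCauchyForm f β ν) (hν : IsPickDensity ν) :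
    IsConstOnUpper f ↔ ∃ θ : ℝ, ∀ x, ν x = θ :=
  ⟨hf.exists_const hν, fun ⟨_, hθ⟩ => ⟨_, fun _ hz => hf.eq_of_const hθ hz⟩⟩

/-! ### Boundary values of the real part -/

lemma logKernel_re (z : ℂ) (t : ℝ) :
    (logKernel z t).re = Real.log (Real.sqrt (1 + t ^ 2) / ‖(t : ℂ) - z‖) := by
  rw [logKernel, Complex.log_re, norm_div, Complex.norm_real,
    Real.norm_of_nonneg (sqrt_one_add_sq_pos t).le]

lemma HasCauchyForm.re_eq (hf : HasCauchyForm f β ν) (hν : IsPickDensity ν) {z : ℂ}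
    (hz : 0 < z.im) :
    (f z).re = β + ∫ t, Real.log (Real.sqrt (1 + t ^ 2) / ‖(t : ℂ) - z‖) ∂(lsMeasure ν hν.1) := by
  have h := integral_re (integrable_logKernel hν hz)
  have h' : ∀ t, RCLike.re (logKernel z t) =
    Real.log (Real.sqrt (1 + t ^ 2) / ‖(t : ℂ) - z‖) := fun t => logKernel_re z t
  simp only [h'] at h
  rw [h, ((hasCauchyForm_iff_hasLogForm f β hν).1 hf).1 z hz]
  simp

end

/-- The local singularity `|log |s||`, cut off to `|s| < 1`. -/
noncomputable def truncLog : ℝ → ℝ := (Ioo (-1) 1).indicator fun s => |Real.log s|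

lemma truncLog_nonneg (s : ℝ) : 0 ≤ truncLog s :=
  indicator_nonneg (fun _ _ => abs_nonneg _) s

lemma measurable_truncLog : Measurable truncLog :=
  (Real.measurable_log.abs).indicator measurableSet_Ioo

lemma integrable_truncLog : Integrable truncLog := by
  have h : IntervalIntegrable Real.log volume (-1) 1 := intervalIntegral.intervalIntegrable_log'
  rw [intervalIntegrable_iff_integrableOn_Ioo_of_le (by norm_num)] at h
  exact (integrable_indicator_iff measurableSet_Ioo).2 h.abs

/-- The convolution of `|log |s||` near zero with a finite measure is finite almost everywhere. -/
lemma ae_integrable_truncLog_sub (μ : Measure ℝ) [IsFiniteMeasure μ] :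
    ∀ᵐ x : ℝ, Integrable (fun t => truncLog (t - x)) μ := by
  have hm : AEStronglyMeasurable (fun p : ℝ × ℝ => truncLog (p.2 - p.1)) (volume.prod μ) :=
    (measurable_truncLog.comp (measurable_snd.sub measurable_fst)).aestronglyMeasurable
  have h : Integrable (fun p : ℝ × ℝ => truncLog (p.2 - p.1)) (volume.prod μ) := by
    -- By translation and reflection invariance the integral over `x` is the same for every `t`,
    -- hence integrable for the finite measure.
    refine (integrable_prod_iff' hm).2
      ⟨Eventually.of_forall fun t => integrable_truncLog.comp_sub_left t, ?_⟩
    have h1 : ∀ t : ℝ, ∫ x : ℝ, ‖truncLog (t - x)‖ = ∫ x : ℝ, ‖truncLog x‖ := fun t =>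
      integral_sub_left_eq_self (fun x => ‖truncLog x‖) volume t
    simp only [h1]
    exact integrable_const _
  exact h.prod_right_ae

lemma sqrt_one_add_sq_le (t : ℝ) : Real.sqrt (1 + t ^ 2) ≤ 1 + |t| := by
  rw [Real.sqrt_le_left (by positivity)]
  nlinarith [abs_nonneg t, sq_abs t]

lemma one_le_sqrt_one_add_sq (t : ℝ) : 1 ≤ Real.sqrt (1 + t ^ 2) :=
  Real.one_le_sqrt.2 (by nlinarith [sq_nonneg t])

lemma abs_le_sqrt_one_add_sq (t : ℝ) : |t| ≤ Real.sqrt (1 + t ^ 2) :=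
  Real.abs_le_sqrt (by linarith)

/-- Near `x` only `log |t - x|` is singular; for `|t - x| ≥ 1` the quotient lies between `1 / (2 +
|x|)` and `2 + |x|`. -/
lemma abs_logPotKernel_le (x t : ℝ) :
    |logPotKernel x t| ≤ Real.log (2 + |x|) + truncLog (t - x) := by
  have hx := abs_nonneg x
  have hlog : 0 ≤ Real.log (2 + |x|) := Real.log_nonneg (by linarith)
  -- At `t = x` division by zero and `log 0` give the value `0` instead of `+∞`.
  rcases eq_or_ne t x with rfl | hne
  · simpa [logPotKernel] using add_nonneg hlog (truncLog_nonneg 0)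
  have hd : 0 < |t - x| := abs_pos.2 (sub_ne_zero.2 hne)
  have hS := sqrt_one_add_sq_pos t
  have hS1 := sqrt_one_add_sq_le t
  have hS2 := one_le_sqrt_one_add_sq t
  have hS3 := abs_le_sqrt_one_add_sq t
  have ht : |t| ≤ |t - x| + |x| := by simpa using abs_add_le (t - x) x
  have ht' : |t - x| ≤ |t| + |x| := abs_sub t x
  have hL1 : Real.log (Real.sqrt (1 + t ^ 2)) ≥ 0 := Real.log_nonneg hS2
  rw [logPotKernel, Real.log_div hS.ne' hd.ne']
  rcases lt_or_ge |t - x| 1 with h1 | h1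
  · have hg : truncLog (t - x) = |Real.log (|t - x|)| := by
      rw [truncLog, indicator_of_mem (mem_Ioo.2 (abs_lt.1 h1)), Real.log_abs]
    have hL2 : Real.log (Real.sqrt (1 + t ^ 2)) ≤ Real.log (2 + |x|) :=
      Real.log_le_log hS (by linarith)
    rw [hg]
    refine (abs_sub _ _).trans ?_
    rw [abs_of_nonneg hL1]
    linarith
  · have h2 : Real.log (Real.sqrt (1 + t ^ 2)) ≤ Real.log (2 + |x|) + Real.log |t - x| := by
      rw [← Real.log_mul (by positivity) hd.ne']
      exact Real.log_le_log hS (by nlinarith)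
    have h3 : Real.log |t - x| ≤ Real.log (2 + |x|) + Real.log (Real.sqrt (1 + t ^ 2)) := by
      rw [← Real.log_mul (by positivity) hS.ne']
      exact Real.log_le_log hd (by nlinarith)
    have := truncLog_nonneg (t - x)
    exact abs_le.2 ⟨by linarith, by linarith⟩

lemma measurable_logPotKernel (x : ℝ) : Measurable (logPotKernel x) := by
  unfold logPotKernel
  fun_prop

lemma integrable_logPotKernel {μ : Measure ℝ} [IsFiniteMeasure μ] {x : ℝ}
    (h : Integrable (fun t => truncLog (t - x)) μ) : Integrable (logPotKernel x) μ :=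
  ((integrable_const (Real.log (2 + |x|))).add h).mono'
    (measurable_logPotKernel x).aestronglyMeasurable
    (Eventually.of_forall (abs_logPotKernel_le x))

/-- Within an angle at `x`, the logarithmic kernels are controlled by the one at `x`. -/
lemma abs_log_div_norm_sub_le {x a t : ℝ} {z : ℂ} (ha : 0 < a) (hz : 0 < z.im)
    (hza : |z.re - x| ≤ a * z.im) (hzx : ‖z - x‖ ≤ 1) (htx : t ≠ x) :
    |Real.log (Real.sqrt (1 + t ^ 2) / ‖(t : ℂ) - z‖)| ≤
      |logPotKernel x t| + (Real.log (1 + a) + Real.log (2 + |x|)) := by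
  have hx := abs_nonneg x
  have hd : 0 < |t - x| := abs_pos.2 (sub_ne_zero.2 htx)
  have hS := sqrt_one_add_sq_pos t
  have hS2 := one_le_sqrt_one_add_sq t
  have hS3 := abs_le_sqrt_one_add_sq t
  have hn : 0 < ‖(t : ℂ) - z‖ := norm_pos_iff.2 (ofReal_sub_ne_zero_of_im_ne_zero hz.ne' t)
  -- In the angle, `|Re z - x| ≤ a Im z ≤ a |t - z|`.
  have h1 : |t - x| ≤ (1 + a) * ‖(t : ℂ) - z‖ := by
    have h2 := abs_im_le_norm_ofReal_sub z t
    rw [abs_of_pos hz] at h2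
    have h3 : |t - z.re| ≤ ‖(t : ℂ) - z‖ := by
      simpa using Complex.abs_re_le_norm ((t : ℂ) - z)
    have h4 : |t - x| ≤ |t - z.re| + |z.re - x| := abs_sub_le _ _ _
    nlinarith
  have h2 : ‖(t : ℂ) - z‖ ≤ (2 + |x|) * Real.sqrt (1 + t ^ 2) := by
    have h3 : ‖(t : ℂ) - z‖ ≤ ‖(t : ℂ) - x‖ + ‖(x : ℂ) - z‖ := norm_sub_le_norm_sub_add_norm_sub _ _ _
    have h4 : ‖(t : ℂ) - x‖ = |t - x| := by
      rw [← Complex.ofReal_sub, Complex.norm_real, Real.norm_eq_abs]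
    have h5 : |t - x| ≤ |t| + |x| := abs_sub t x
    rw [norm_sub_rev (x : ℂ) z] at h3
    nlinarith
  have h3 := Real.log_le_log hd h1
  have h4 := Real.log_le_log hn h2
  rw [Real.log_mul (by positivity) hn.ne'] at h3
  rw [Real.log_mul (by positivity) hS.ne'] at h4
  rw [logPotKernel, Real.log_div hS.ne' hd.ne', Real.log_div hS.ne' hn.ne']
  have h5 : 0 ≤ Real.log (1 + a) := Real.log_nonneg (by linarith)
  have h6 : 0 ≤ Real.log (2 + |x|) := Real.log_nonneg (by linarith)
  have h7 := le_abs_self (Real.log (Real.sqrt (1 + t ^ 2)) - Real.log |t - x|)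
  have h8 := abs_nonneg (Real.log (Real.sqrt (1 + t ^ 2)) - Real.log |t - x|)
  exact abs_le.2 ⟨by linarith, by linarith⟩

lemma HasCauchyForm.hasNontangentialLimit_re {f : ℂ → ℂ} {β : ℝ} {ν : ℝ → ℝ}
    (hf : HasCauchyForm f β ν) (hν : IsPickDensity ν) {x : ℝ} (hx : lsMeasure ν hν.1 {x} = 0)
    (hint : Integrable (logPotKernel x) (lsMeasure ν hν.1)) :
    HasNontangentialLimit (fun z => (f z).re) x
      (β + ∫ t : ℝ, logPotKernel x t ∂(lsMeasure ν hν.1)) := by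
  have := hν.isFiniteMeasure_lsMeasure
  intro a ha
  set s : Set ℂ := {z : ℂ | 0 < z.im ∧ |z.re - x| ≤ a * z.im}
  have hne : ∀ᵐ t ∂(lsMeasure ν hν.1), t ≠ x := compl_mem_ae_iff.2 hx
  have hlim : Tendsto (fun z : ℂ => ∫ t, Real.log (Real.sqrt (1 + t ^ 2) / ‖(t : ℂ) - z‖)
      ∂(lsMeasure ν hν.1)) (𝓝[s] x) (𝓝 (∫ t, logPotKernel x t ∂(lsMeasure ν hν.1))) := by
    refine tendsto_integral_filter_of_dominated_convergence
      (fun t => |logPotKernel x t| + (Real.log (1 + a) + Real.log (2 + |x|)))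
      (Eventually.of_forall fun z => ?_) ?_ (hint.abs.add (integrable_const _)) ?_
    · exact Measurable.aestronglyMeasurable (by fun_prop)
    · have hball : ∀ᶠ z in 𝓝[s] (x : ℂ), z ∈ Metric.closedBall (x : ℂ) 1 :=
        mem_nhdsWithin_of_mem_nhds (Metric.closedBall_mem_nhds _ one_pos)
      filter_upwards [hball, self_mem_nhdsWithin] with z hz1 hz
      filter_upwards [hne] with t ht
      exact abs_log_div_norm_sub_le ha hz.1 hz.2 (mem_closedBall_iff_norm.1 hz1) ht
    · filter_upwards [hne] with t ht
      have h0 : (t : ℂ) - x ≠ 0 := by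
        rw [← Complex.ofReal_sub]
        exact_mod_cast sub_ne_zero.2 ht
      have hc : ContinuousAt (fun z : ℂ => Real.log (Real.sqrt (1 + t ^ 2) / ‖(t : ℂ) - z‖))
          (x : ℂ) := by
        refine ContinuousAt.log (ContinuousAt.div (by fun_prop) (by fun_prop) (by simpa using h0)) ?_
        exact div_ne_zero (sqrt_one_add_sq_pos t).ne' (by simpa using h0)
      have h1 := hc.tendsto.mono_left (nhdsWithin_le_nhds (s := s))
      have h2 : ‖(t : ℂ) - x‖ = |t - x| := by
        rw [← Complex.ofReal_sub, Complex.norm_real, Real.norm_eq_abs]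
      rwa [h2] at h1
  refine (hlim.const_add β).congr' ?_
  filter_upwards [self_mem_nhdsWithin] with z hz
  exact (hf.re_eq hν hz.1).symm

lemma IsPickDensity.ae_logPotKernel {ν : ℝ → ℝ} (hν : IsPickDensity ν) :
    ∀ᵐ x : ℝ, lsMeasure ν hν.1 {x} = 0 ∧ Integrable (logPotKernel x) (lsMeasure ν hν.1) := by
  have := hν.isFiniteMeasure_lsMeasure
  filter_upwards [hν.ae_continuousAt, ae_integrable_truncLog_sub (lsMeasure ν hν.1)] with x h1 h2
  exact ⟨hν.lsMeasure_singleton h1, integrable_logPotKernel h2⟩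

/-! ### Vanishing of bounded harmonic functions with zero boundary values -/

/-- If `h` is holomorphic in the upper half plane, `Im h` is bounded above, and
`Im h ≤ C` on the line `Im z = δ`, then `Im h ≤ C` above this line. -/
lemma im_le_of_im_le_on_line {h : ℂ → ℂ} (hd : DifferentiableOn ℂ h {z : ℂ | 0 < z.im}) {M C δ : ℝ}
    (hM : ∀ z : ℂ, 0 < z.im → (h z).im ≤ M) (hδ : 0 < δ)
    (hC : ∀ x : ℝ, (h (x + δ * Complex.I)).im ≤ C) {z : ℂ} (hz : δ ≤ z.im) : (h z).im ≤ C := by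
  -- The right half plane is rotated onto `Im > δ`, and `|F|` becomes `exp (Im h)`. The boundary
  -- line lies inside the domain of `h`, so `F` is holomorphic up to the boundary.
  set F : ℂ → ℂ := fun w => Complex.exp (-(Complex.I * h (Complex.I * w + δ * Complex.I)))
  have hmap : ∀ w : ℂ, 0 ≤ w.re → 0 < (Complex.I * w + δ * Complex.I).im := fun w hw => by
    simpa using by linarith
  have hF : ∀ w : ℂ, ‖F w‖ = Real.exp (h (Complex.I * w + δ * Complex.I)).im := fun w => by
    simp [F, Complex.norm_exp]
  have hFd : DiffContOnCl ℂ F {w | 0 < w.re} := by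
    refine DifferentiableOn.diffContOnCl ?_
    rw [Complex.closure_setOfPred_lt_re]
    refine DifferentiableOn.cexp (DifferentiableOn.neg (DifferentiableOn.const_mul ?_ _))
    exact hd.comp (by fun_prop) fun w hw => hmap w hw
  have hFM : ∀ w : ℂ, 0 ≤ w.re → ‖F w‖ ≤ Real.exp M := fun w hw => by
    rw [hF]
    exact Real.exp_le_exp.2 (hM _ (hmap w hw))
  have hle : ‖F (-Complex.I * (z - δ * Complex.I))‖ ≤ Real.exp C := by
    refine PhragmenLindelof.right_half_plane_of_bounded_on_real hFd ⟨1, by norm_num, 0, ?_⟩ ?_ ?_ ?_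
    · refine Asymptotics.IsBigO.of_bound (Real.exp M) ?_
      have : ∀ᶠ w in Bornology.cobounded ℂ ⊓ 𝓟 {w : ℂ | 0 < w.re}, w ∈ {w : ℂ | 0 < w.re} :=
        mem_inf_of_right (mem_principal_self _)
      filter_upwards [this] with w hw
      simpa using hFM w (le_of_lt hw)
    · refine isBoundedUnder_of_eventually_le (a := Real.exp M) ?_
      filter_upwards [eventually_ge_atTop 0] with x hx
      exact hFM x (by simpa using hx)
    · intro x
      rw [hF]
      have h1 : Complex.I * (x * Complex.I) + δ * Complex.I = ((-x : ℝ) : ℂ) + δ * Complex.I := by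
        push_cast
        linear_combination (x : ℂ) * Complex.I_mul_I
      rw [h1]
      exact Real.exp_le_exp.2 (hC _)
    · simpa using hz
  rw [hF] at hle
  have h2 : Complex.I * (-Complex.I * (z - δ * Complex.I)) + δ * Complex.I = z := by
    linear_combination -(z - δ * Complex.I) * Complex.I_mul_I
  rw [h2] at hle
  exact Real.exp_le_exp.1 hle

lemma im_eq_zero_of_tendsto_zero {h : ℂ → ℂ} (hd : DifferentiableOn ℂ h {z : ℂ | 0 < z.im}) {M : ℝ}
    (hM : ∀ z : ℂ, 0 < z.im → |(h z).im| ≤ M) {η : ℝ → ℝ} (hη : Tendsto η (𝓝[>] 0) (𝓝 0))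
    (hηh : ∀ δ : ℝ, 0 < δ → ∀ x : ℝ, |(h (x + δ * Complex.I)).im| ≤ η δ) {z : ℂ} (hz : 0 < z.im) :
    (h z).im = 0 := by
  have key : ∀ᶠ δ in 𝓝[>] (0 : ℝ), |(h z).im| ≤ η δ := by
    filter_upwards [self_mem_nhdsWithin, mem_nhdsWithin_of_mem_nhds (Iio_mem_nhds hz)] with δ h1 h2
    refine abs_le'.2 ⟨?_, ?_⟩
    · exact im_le_of_im_le_on_line hd (fun z hz => (abs_le'.1 (hM z hz)).1) h1
        (fun x => (abs_le'.1 (hηh δ h1 x)).1) h2.le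
    · have := im_le_of_im_le_on_line (h := fun z => -h z) hd.neg (M := M) (C := η δ)
        (fun z hz => by simpa using (abs_le'.1 (hM z hz)).2) h1
        (fun x => by simpa using (abs_le'.1 (hηh δ h1 x)).2) h2.le
      simpa using this
  exact abs_nonpos_iff.1 (ge_of_tendsto hη key)

/-- The density given by the values of `Im f` on the line `Im z = ε`. -/
noncomputable def lineDensity (f : ℂ → ℂ) (ε x : ℝ) : ℝ :=
  (f (x + ε * Complex.I)).im / Real.pi

/-! ### Lipschitz bound away from the real line -/

namespace IsStripPrimitive

variable {f : ℂ → ℂ}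

/-- Only `Im f` is bounded, so Cauchy's estimate is applied to `exp (i f)`, whose modulus lies in
`[exp (-π), 1]`, on the disc of radius `Im z / 2`. -/
lemma norm_deriv_le (hf : IsStripPrimitive f) {z : ℂ} (hz : 0 < z.im) :
    ‖deriv f z‖ ≤ 2 * Real.exp Real.pi / z.im := by
  have hball : ∀ w ∈ Metric.closedBall z (z.im / 2), 0 < w.im := fun w hw => by
    rw [mem_closedBall_iff_norm] at hw
    have h1 := (Complex.abs_im_le_norm (w - z)).trans hw
    rw [Complex.sub_im] at h1
    linarith [(abs_le.1 h1).1]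
  have hd : DifferentiableOn ℂ (fun w => Complex.exp (Complex.I * f w))
      (Metric.closedBall z (z.im / 2)) :=
    ((hf.differentiableOn.mono fun w hw => (hball w hw).ne').const_mul _).cexp
  have hn : ∀ w : ℂ, ‖Complex.exp (Complex.I * f w)‖ = Real.exp (-(f w).im) := fun w => by
    simp [Complex.norm_exp]
  have h1 := Complex.norm_deriv_le_of_forall_mem_sphere_norm_le (half_pos hz)
    (hd.mono Metric.closure_ball_subset_closedBall).diffContOnCl (C := 1) fun w hw => by
      rw [hn]
      exact Real.exp_le_one_iff.2
        (neg_nonpos.2 (hf.im_mem w (hball w (Metric.sphere_subset_closedBall hw))).1)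
  have h2 := ((differentiableAt_of_im_ne_zero hf.differentiableOn hz.ne').hasDerivAt.const_mul
    Complex.I).cexp.deriv
  rw [h2, norm_mul, hn, norm_mul, Complex.norm_I, one_mul] at h1
  have h3 : Real.exp (-Real.pi) ≤ Real.exp (-(f z).im) :=
    Real.exp_le_exp.2 (neg_le_neg (hf.im_mem z hz).2)
  have h4 : Real.exp (-Real.pi) * ‖deriv f z‖ ≤ 1 / (z.im / 2) :=
    (mul_le_mul_of_nonneg_right h3 (norm_nonneg _)).trans h1
  calc ‖deriv f z‖ = Real.exp Real.pi * (Real.exp (-Real.pi) * ‖deriv f z‖) := by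
        rw [← mul_assoc, ← Real.exp_add]
        simp
    _ ≤ Real.exp Real.pi * (1 / (z.im / 2)) := by gcongr
    _ = 2 * Real.exp Real.pi / z.im := by field_simp

lemma abs_im_sub_le (hf : IsStripPrimitive f) {ε : ℝ} (hε : 0 < ε) {z w : ℂ} (hz : ε ≤ z.im)
    (hw : ε ≤ w.im) : |(f w).im - (f z).im| ≤ 2 * Real.exp Real.pi / ε * ‖w - z‖ := by
  have h := (convex_halfSpace_im_ge ε).norm_image_sub_le_of_norm_deriv_le (𝕜 := ℂ) (f := f)
    (C := 2 * Real.exp Real.pi / ε)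
    (fun u hu => differentiableAt_of_im_ne_zero hf.differentiableOn (hε.trans_le hu).ne')
    (fun u hu => (hf.norm_deriv_le (hε.trans_le hu)).trans
      (div_le_div_of_nonneg_left (by positivity) hε hu)) hz hw
  rw [← Complex.sub_im]
  exact (Complex.abs_im_le_norm _).trans h

/-! ### The Poisson representation on a shifted half plane -/

lemma isPickDensity_lineDensity (hf : IsStripPrimitive f) {ε : ℝ} (hε : 0 < ε) :
    IsPickDensity (lineDensity f ε) := by
  refine ⟨fun a b hab => div_le_div_of_nonneg_right (hf.im_mono hε hab) Real.pi_pos.le, fun x => ?_⟩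
  have h := hf.im_mem (x + ε * Complex.I) (by simpa using hε)
  exact ⟨div_nonneg h.1 Real.pi_pos.le, (div_le_one Real.pi_pos).2 h.2⟩

lemma integrable_inv_one_add_sq_mul_min {L : ℝ} (hL : 0 ≤ L) {δ : ℝ} (hδ : 0 < δ) :
    Integrable fun s : ℝ => (1 + s ^ 2)⁻¹ * min (L * (δ * |s|)) 1 := by
  refine integrable_inv_one_add_sq.mono' ?_ (Eventually.of_forall fun s => ?_)
  · exact Measurable.aestronglyMeasurable (by fun_prop)
  · rw [Real.norm_of_nonneg (by positivity)]
    exact mul_le_of_le_one_right (by positivity) (min_le_right _ _)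

lemma tendsto_modulus {L : ℝ} (hL : 0 ≤ L) : Tendsto (fun δ : ℝ => L * δ +
    ∫ s : ℝ, (1 + s ^ 2)⁻¹ * min (L * (δ * |s|)) 1) (𝓝[>] 0) (𝓝 0) := by
  have h1 : Tendsto (fun δ : ℝ => L * δ) (𝓝[>] 0) (𝓝 0) :=
    ((continuous_const.mul continuous_id).tendsto' 0 0 (by simp)).mono_left nhdsWithin_le_nhds
  have h2 : Tendsto (fun δ : ℝ => ∫ s : ℝ, (1 + s ^ 2)⁻¹ * min (L * (δ * |s|)) 1) (𝓝[>] 0)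
      (𝓝 (∫ _ : ℝ, (0 : ℝ))) := by
    refine tendsto_integral_filter_of_dominated_convergence (fun s => (1 + s ^ 2)⁻¹)
      ?_ ?_ integrable_inv_one_add_sq (Eventually.of_forall fun s => ?_)
    · filter_upwards [self_mem_nhdsWithin] with δ hδ
      exact (integrable_inv_one_add_sq_mul_min hL hδ).1
    · filter_upwards [self_mem_nhdsWithin] with δ (hδ : 0 < δ)
      refine Eventually.of_forall fun s => ?_
      rw [Real.norm_of_nonneg (by positivity)]
      exact mul_le_of_le_one_right (by positivity) (min_le_right _ _)
    · have hc : Continuous fun δ : ℝ => (1 + s ^ 2)⁻¹ * min (L * (δ * |s|)) 1 := by fun_prop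
      exact (hc.tendsto' 0 0 (by simp)).mono_left nhdsWithin_le_nhds
  simpa using h1.add h2

/-- The Lipschitz bound alone is not integrable against `1 / (1 + s ^ 2)`; the cap `1` makes it so.
-/
lemma abs_lineDensity_sub_le (hf : IsStripPrimitive f) {ε : ℝ} (hε : 0 < ε) (a b : ℝ) :
    |lineDensity f ε b - lineDensity f ε a| ≤
      min (2 * Real.exp Real.pi / ε * |b - a|) 1 := by
  have hν := hf.isPickDensity_lineDensity hε
  refine le_min ?_ ?_
  · have h := hf.abs_im_sub_le hε (z := a + ε * Complex.I) (w := b + ε * Complex.I) (by simp)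
      (by simp)
    have h1 : ‖(b + ε * Complex.I : ℂ) - (a + ε * Complex.I)‖ = |b - a| := by
      rw [add_sub_add_right_eq_sub, ← Complex.ofReal_sub, Complex.norm_real, Real.norm_eq_abs]
    rw [h1] at h
    rw [lineDensity, lineDensity, ← sub_div, abs_div, abs_of_pos Real.pi_pos]
    exact (div_le_self (abs_nonneg _) (by linarith [Real.pi_gt_three])).trans h
  · have h1 := hν.2 a
    have h2 := hν.2 b
    exact abs_le.2 ⟨by linarith [h1.2, h2.1], by linarith [h1.1, h2.2]⟩

/-- Both terms are compared with `Im f(x + iε)`: the vertical shift costs the first summand, Poisson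
averaging the second. The bound is uniform in `x`. -/
lemma abs_im_sub_cauchyTransform_le (hf : IsStripPrimitive f) {ε δ : ℝ} (hε : 0 < ε) (hδ : 0 < δ)
    (x : ℝ) : |(f (x + δ * Complex.I + ε * Complex.I)).im -
      (cauchyTransform (lineDensity f ε) (x + δ * Complex.I)).im| ≤
      2 * Real.exp Real.pi / ε * δ +
        ∫ s : ℝ, (1 + s ^ 2)⁻¹ * min (2 * Real.exp Real.pi / ε * (δ * |s|)) 1 := by
  have hν := hf.isPickDensity_lineDensity hε
  have hL : 0 ≤ 2 * Real.exp Real.pi / ε := by positivity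
  have h1 : |(f (x + δ * Complex.I + ε * Complex.I)).im - (f (x + ε * Complex.I)).im| ≤
      2 * Real.exp Real.pi / ε * δ := by
    have h := hf.abs_im_sub_le hε (z := x + ε * Complex.I)
      (w := x + δ * Complex.I + ε * Complex.I) (by simp) (by simpa using hδ.le)
    have h2 : (x + δ * Complex.I + ε * Complex.I : ℂ) - (x + ε * Complex.I) = δ * Complex.I := by
      ring
    rw [h2, norm_mul, Complex.norm_I, mul_one, Complex.norm_real, Real.norm_of_nonneg hδ.le] at h
    exact h
  have h2 : (cauchyTransform (lineDensity f ε) (x + δ * Complex.I)).im =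
      ∫ s : ℝ, (1 + s ^ 2)⁻¹ * lineDensity f ε (x + δ * s) := by
    rw [cauchyTransform_im hν (by simpa using hδ)]
    simp
  have h3 : (f (x + ε * Complex.I)).im = ∫ s : ℝ, (1 + s ^ 2)⁻¹ * lineDensity f ε x := by
    rw [integral_mul_const, integral_univ_inv_one_add_sq, lineDensity,
      mul_div_cancel₀ _ Real.pi_ne_zero]
  have h4 : |(f (x + ε * Complex.I)).im -
      (cauchyTransform (lineDensity f ε) (x + δ * Complex.I)).im| ≤
      ∫ s : ℝ, (1 + s ^ 2)⁻¹ * min (2 * Real.exp Real.pi / ε * (δ * |s|)) 1 := by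
    rw [h2, h3, ← integral_sub (integrable_inv_one_add_sq.mul_const _)
      (hν.integrable_inv_one_add_sq_mul x δ), ← Real.norm_eq_abs]
    refine norm_integral_le_of_norm_le (integrable_inv_one_add_sq_mul_min hL hδ)
      (Eventually.of_forall fun s => ?_)
    have h5 := hf.abs_lineDensity_sub_le hε (x + δ * s) x
    have h6 : |x - (x + δ * s)| = δ * |s| := by
      rw [sub_add_cancel_left, abs_neg, abs_mul, abs_of_pos hδ]
    rw [h6] at h5
    rw [← mul_sub, norm_mul, Real.norm_of_nonneg (by positivity), Real.norm_eq_abs]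
    gcongr
  exact (abs_sub_le _ _ _).trans (add_le_add h1 h4)

lemma im_add_eq_cauchyTransform (hf : IsStripPrimitive f) {ε : ℝ} (hε : 0 < ε) {z : ℂ}
    (hz : 0 < z.im) : (f (z + ε * Complex.I)).im = (cauchyTransform (lineDensity f ε) z).im := by
  have hν := hf.isPickDensity_lineDensity hε
  have hmap : ∀ w : ℂ, 0 < w.im → 0 < (w + ε * Complex.I).im := fun w hw => by
    simpa using add_pos hw hε
  have hd : DifferentiableOn ℂ (fun w => f (w + ε * Complex.I) - cauchyTransform (lineDensity f ε) w)
      {z : ℂ | 0 < z.im} :=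
    (hf.differentiableOn.comp (by fun_prop) fun w hw => (hmap w hw).ne').sub
      ((differentiableOn_cauchyTransform hν).mono fun w hw => ne_of_gt hw)
  have h := im_eq_zero_of_tendsto_zero hd (M := Real.pi) (fun w hw => by
    have h1 := hf.im_mem _ (hmap w hw)
    have h2 := cauchyTransform_im_mem_Icc hν hw
    rw [Complex.sub_im]
    exact abs_le.2 ⟨by linarith [h1.1, h2.2], by linarith [h1.2, h2.1]⟩)
    (tendsto_modulus (L := 2 * Real.exp Real.pi / ε) (by positivity))
    (fun δ hδ x => by
      rw [Complex.sub_im]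
      exact hf.abs_im_sub_cauchyTransform_le hε hδ x) hz
  rwa [Complex.sub_im, sub_eq_zero] at h

end IsStripPrimitive

/-! ### Selection and the representation theorem -/

/-- Helly's selection theorem for nondecreasing functions with values in `[0, 1]`. -/
lemma exists_subseq_tendsto_of_isPickDensity {u : ℕ → ℝ → ℝ} (hu : ∀ k, IsPickDensity (u k)) :
    ∃ (φ : ℕ → ℕ) (ν : ℝ → ℝ), StrictMono φ ∧ IsPickDensity ν ∧
      ∀ x, ContinuousAt ν x → Tendsto (fun k => u (φ k) x) atTop (𝓝 (ν x)) := by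
  -- Compactness of `[0, 1]^ℚ` gives convergence at all rationals; the lower limit then extends the
  -- limit monotonically to the reals.
  obtain ⟨a, φ, hφ, ha⟩ := CompactSpace.tendsto_subseq
    (fun k (q : ℚ) => (⟨u k q, (hu k).2 q⟩ : Icc (0 : ℝ) 1))
  have hlim : ∀ q : ℚ, Tendsto (fun k => u (φ k) q) atTop (𝓝 (a q : ℝ)) := fun q =>
    (continuous_subtype_val.tendsto _).comp ((tendsto_pi_nhds.1 ha) q)
  have hba : ∀ x, IsBoundedUnder (· ≤ ·) atTop fun k => u (φ k) x := fun x =>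
    isBoundedUnder_of ⟨1, fun k => ((hu _).2 x).2⟩
  have hbb : ∀ x, IsBoundedUnder (· ≥ ·) atTop fun k => u (φ k) x := fun x =>
    isBoundedUnder_of ⟨0, fun k => ((hu _).2 x).1⟩
  set ν : ℝ → ℝ := fun x => liminf (fun k => u (φ k) x) atTop
  have hνq : ∀ q : ℚ, Tendsto (fun k => u (φ k) q) atTop (𝓝 (ν q)) := fun q => by
    have : ν q = a q := (hlim q).liminf_eq
    rw [this]
    exact hlim q
  refine ⟨φ, ν, hφ, ⟨fun x y hxy => ?_, fun x => ⟨?_, ?_⟩⟩, fun x hx => ?_⟩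
  · exact liminf_le_liminf (Eventually.of_forall fun k => (hu _).1 hxy) (hbb x)
      (hba y).isCoboundedUnder_ge
  · exact le_liminf_of_le (hba x).isCoboundedUnder_ge
      (Eventually.of_forall fun k => ((hu _).2 x).1)
  · exact liminf_le_of_le (hbb x) fun b hb => by
      obtain ⟨k, hk⟩ := hb.exists
      exact hk.trans ((hu _).2 x).2
  -- By continuity at `x` there are rationals on either side where `ν` is still on the right side of
  -- `c`; monotonicity of `u` carries the estimate to `x`.
  · refine tendsto_order.2 ⟨fun c hc => ?_, fun c hc => ?_⟩
    · obtain ⟨l, hl, hl'⟩ := exists_Ioc_subset_of_mem_nhds (hx.eventually (lt_mem_nhds hc))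
        (exists_lt x)
      obtain ⟨q, hq1, hq2⟩ := exists_rat_btwn hl
      filter_upwards [(hνq q).eventually (lt_mem_nhds (hl' ⟨hq1, hq2.le⟩))] with k hk
      exact hk.trans_le ((hu _).1 hq2.le)
    · obtain ⟨l, hl, hl'⟩ := exists_Ico_subset_of_mem_nhds (hx.eventually (gt_mem_nhds hc))
        (exists_gt x)
      obtain ⟨q, hq1, hq2⟩ := exists_rat_btwn hl
      filter_upwards [(hνq q).eventually (gt_mem_nhds (hl' ⟨hq1.le, hq2⟩))] with k hk
      exact ((hu _).1 hq1.le).trans_lt hk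

namespace IsStripPrimitive

variable {f : ℂ → ℂ}

lemma exists_im_eq_cauchyTransform (hf : IsStripPrimitive f) :
    ∃ ν : ℝ → ℝ, IsPickDensity ν ∧
      ∀ z : ℂ, 0 < z.im → (f z).im = (cauchyTransform ν z).im := by
  set ε : ℕ → ℝ := fun k => 1 / ((k : ℝ) + 1)
  have hε : ∀ k, 0 < ε k := fun k => Nat.one_div_pos_of_nat
  have hε0 : Tendsto ε atTop (𝓝 0) := tendsto_one_div_add_atTop_nhds_zero_nat
  obtain ⟨φ, ν, hφ, hν, hlim⟩ := exists_subseq_tendsto_of_isPickDensity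
    (u := fun k => lineDensity f (ε k)) fun k => hf.isPickDensity_lineDensity (hε k)
  refine ⟨ν, hν, fun z hz => ?_⟩
  have h1 : Tendsto (fun k => (f (z + ε (φ k) * Complex.I)).im) atTop (𝓝 (f z).im) := by
    have hc : ContinuousAt (fun e : ℝ => (f (z + e * Complex.I)).im) 0 := by
      refine Complex.continuous_im.continuousAt.comp (ContinuousAt.comp (g := f) ?_ (by fun_prop))
      exact (differentiableAt_of_im_ne_zero hf.differentiableOn (by simpa using hz.ne')).continuousAt
    have h := hc.tendsto.comp (hε0.comp hφ.tendsto_atTop)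
    simpa [Function.comp_def] using h
  have h2 : Tendsto (fun k => (f (z + ε (φ k) * Complex.I)).im) atTop
      (𝓝 (cauchyTransform ν z).im) := by
    simp only [fun k => hf.im_add_eq_cauchyTransform (hε (φ k)) hz,
      fun k => cauchyTransform_im (hf.isPickDensity_lineDensity (hε (φ k))) hz,
      cauchyTransform_im hν hz]
    refine tendsto_integral_of_dominated_convergence (fun s => (1 + s ^ 2)⁻¹)
      (fun k => ((hf.isPickDensity_lineDensity (hε (φ k))).integrable_inv_one_add_sq_mul _ _).1)
      integrable_inv_one_add_sq (fun k => Eventually.of_forall fun s => ?_) ?_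
    · rw [norm_mul, Real.norm_of_nonneg (by positivity)]
      exact mul_le_of_le_one_right (by positivity)
        ((hf.isPickDensity_lineDensity (hε (φ k))).norm_le_one _)
    -- Convergence can fail only where `x + y s` hits a jump of `ν`, hence for countably many `s`.
    · have hcount : {s : ℝ | ¬ ContinuousAt ν (z.re + z.im * s)}.Countable := by
        refine hν.1.countable_not_continuousAt.preimage (f := fun s : ℝ => z.re + z.im * s) ?_
        intro a b hab
        exact mul_left_cancel₀ hz.ne' (add_left_cancel hab)
      filter_upwards [hcount.ae_notMem volume] with s hs
      exact (hlim _ (not_not.1 hs)).const_mul _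
  exact tendsto_nhds_unique h1 h2

theorem exists_hasCauchyForm (hf : IsStripPrimitive f) :
    ∃ (β : ℝ) (ν : ℝ → ℝ), IsPickDensity ν ∧ HasCauchyForm f β ν := by
  obtain ⟨ν, hν, him⟩ := hf.exists_im_eq_cauchyTransform
  have hsub : ∀ z : ℂ, 0 < z.im → (f z - cauchyTransform ν z).im = 0 := fun z hz => by
    rw [Complex.sub_im, him z hz, sub_self]
  obtain ⟨c, hc⟩ := isConstOnUpper_of_im_eq_zero (g := fun z => f z - cauchyTransform ν z)
    ((hf.differentiableOn.sub (differentiableOn_cauchyTransform hν)).mono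
      fun z hz => ne_of_gt hz) (fun z hz => (hsub z hz).ge) (z₀ := Complex.I) (by simp)
    (hsub _ (by simp))
  replace hc : ∀ z : ℂ, 0 < z.im → f z - cauchyTransform ν z = c := hc
  have hcre : c = (c.re : ℂ) := by
    have h := hsub Complex.I (by simp)
    rw [hc Complex.I (by simp)] at h
    apply Complex.ext <;> simp [h]
  have hup : ∀ z : ℂ, 0 < z.im → f z = (c.re : ℂ) + cauchyTransform ν z := fun z hz => by
    rw [← hcre, ← hc z hz, sub_add_cancel]
  refine ⟨c.re, ν, hν, hasCauchyForm_iff.2 fun z hz => ?_⟩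
  rcases lt_or_gt_of_ne hz with hz | hz
  · rw [hf.symm z hz, hup _ (by simpa using hz), cauchyTransform_conj]
    simp
  · exact hup z hz

end IsStripPrimitive

lemma mem_inter_iff_exists_hasCauchyForm {f : ℂ → ℂ} :
    f ∈ PrimPickClass ∩ LogPickClass ↔
      ∃ (β : ℝ) (ν : ℝ → ℝ), IsPickDensity ν ∧ HasCauchyForm f β ν := by
  rw [mem_primPickClass_inter_logPickClass_iff]
  exact ⟨fun hf => hf.exists_hasCauchyForm, fun ⟨_, _, hν, hf⟩ => hf.isStripPrimitive hν⟩

theorem theorem2p3 :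
    -- every function of the class has both forms, and every function of either form is in it
    (∀ f : ℂ → ℂ, f ∈ PrimPickClass ∩ LogPickClass ↔
      ∃ (β : ℝ) (ν : ℝ → ℝ), IsPickDensity ν ∧ HasCauchyForm f β ν) ∧
    (∀ f : ℂ → ℂ, f ∈ PrimPickClass ∩ LogPickClass ↔
      ∃ (β : ℝ) (ν : ℝ → ℝ) (hν : IsPickDensity ν), HasLogForm f β ν hν.1) ∧
    -- the two forms are the same, with the same data, and their integrals converge absolutely
    (∀ (f : ℂ → ℂ) (β : ℝ) (ν : ℝ → ℝ) (hν : IsPickDensity ν),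
      HasCauchyForm f β ν ↔ HasLogForm f β ν hν.1) ∧
    (∀ (ν : ℝ → ℝ) (hν : IsPickDensity ν),
      (∀ z : ℂ, z.im ≠ 0 → Integrable (fun t : ℝ => pickKernel z t * (ν t : ℂ)) volume) ∧
      (∀ z : ℂ, 0 < z.im → Integrable (logKernel z) (lsMeasure ν hν.1))) ∧
    -- uniqueness, exactly up to equality almost everywhere
    (∀ (f : ℂ → ℂ) (β₁ β₂ : ℝ) (ν₁ ν₂ : ℝ → ℝ), IsPickDensity ν₁ → IsPickDensity ν₂ →
      HasCauchyForm f β₁ ν₁ →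
        (HasCauchyForm f β₂ ν₂ ↔ β₁ = β₂ ∧ ν₁ =ᵐ[volume] ν₂)) ∧
    (∀ (f : ℂ → ℂ) (β₁ β₂ : ℝ) (ν₁ ν₂ : ℝ → ℝ) (hν₁ : IsPickDensity ν₁)
      (hν₂ : IsPickDensity ν₂), HasLogForm f β₁ ν₁ hν₁.1 →
        (HasLogForm f β₂ ν₂ hν₂.1 ↔ β₁ = β₂ ∧ ν₁ =ᵐ[volume] ν₂)) ∧
    -- boundary values and constancy, for a function with data `β`, `ν`
    (∀ (f : ℂ → ℂ) (β : ℝ) (ν : ℝ → ℝ) (hν : IsPickDensity ν), HasCauchyForm f β ν →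
      -- the first clause says that the kernel is finite almost everywhere for `dν`
      (∀ᵐ x : ℝ, lsMeasure ν hν.1 {x} = 0 ∧
        Integrable (logPotKernel x) (lsMeasure ν hν.1) ∧
        HasNontangentialLimit (fun z => (f z).re) x
          (β + ∫ t : ℝ, logPotKernel x t ∂(lsMeasure ν hν.1))) ∧
      (IsMidpointNormalized ν → ∀ x : ℝ,
        Tendsto (fun y : ℝ => (f ((x : ℂ) + (y : ℂ) * Complex.I)).im) (𝓝[>] 0)
          (𝓝 (Real.pi * ν x))) ∧
      (IsConstOnUpper f ↔ ∃ θ : ℝ, ∀ x, ν x = θ) ∧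
      (IsConstOnUpper f → ∃ θ ∈ Icc (0 : ℝ) 1, (∀ x, ν x = θ) ∧
        ∀ z : ℂ, 0 < z.im → f z = (β : ℂ) + Complex.I * (Real.pi : ℂ) * (θ : ℂ))) ∧
    -- strict positivity for the non-constant functions of the class
    (∀ f ∈ PrimPickClass ∩ LogPickClass, ¬ IsConstOnUpper f →
      ∀ z : ℂ, 0 < z.im → 0 < (f z).im ∧ 0 < (deriv f z).im) := by
  refine ⟨fun f => mem_inter_iff_exists_hasCauchyForm, fun f => ?_,
    fun f β ν hν => hasCauchyForm_iff_hasLogForm f β hν,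
    fun ν hν => ⟨fun z hz => integrable_pickKernel_mul hν hz, fun z hz => integrable_logKernel hν hz⟩,
    fun f β₁ β₂ ν₁ ν₂ hν₁ hν₂ h => h.iff_of_hasCauchyForm hν₁ hν₂, fun f β₁ β₂ ν₁ ν₂ hν₁ hν₂ h => ?_,
    fun f β ν hν hf => ⟨?_, fun hmid x => ?_, hf.isConstOnUpper_iff hν, fun hc => ?_⟩,
    fun f hf hc z hz => ?_⟩
  · rw [mem_inter_iff_exists_hasCauchyForm]
    exact ⟨fun ⟨β, ν, hν, h⟩ => ⟨β, ν, hν, (hasCauchyForm_iff_hasLogForm f β hν).1 h⟩,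
      fun ⟨β, ν, hν, h⟩ => ⟨β, ν, hν, (hasCauchyForm_iff_hasLogForm f β hν).2 h⟩⟩
  · rw [← hasCauchyForm_iff_hasLogForm f β₂ hν₂]
    exact ((hasCauchyForm_iff_hasLogForm f β₁ hν₁).2 h).iff_of_hasCauchyForm hν₁ hν₂
  · filter_upwards [hν.ae_logPotKernel] with x hx
    exact ⟨hx.1, hx.2, hf.hasNontangentialLimit_re hν hx.1 hx.2⟩
  · rw [hmid x]
    exact hf.tendsto_im hν x
  · obtain ⟨θ, hθ⟩ := hf.exists_const hν hc
    exact ⟨θ, hθ 0 ▸ hν.2 0, hθ, fun z hz => hf.eq_of_const hθ hz⟩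
  · have hf' := mem_primPickClass_inter_logPickClass_iff.1 hf
    exact ⟨hf'.im_pos hc hz, hf'.deriv_im_pos hc hz⟩
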